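/- Let $f_{21},f_{31}$ (in $u$), $f_{24},f_{33},f_{34}$ (in $(u,s)$) and $f_{32}$ (in $(u,v,s)$) be germs at the origin of real $C^\infty$ functions with $f_{32}(0,0,0)=0$, $f_{33}(0,s)=s$, $(f_{33})_u(0,0)=0$, and set $$f^s(u,v)=\bigl(u,\;u^2f_{21}(u)+v^2+us f_{24}(u,s),\;u^2f_{31}(u)+v^2f_{32}(u,v,s)+vf_{33}(u,s)+us f_{34}(u,s)\bigr).$$ Assume that $f^0$ has an $S_1^+$ or $S_1^-$ singularity at $0$, i.e. is $\mathcal A$-equivalent to $(u,v)\mapsto(u,v^2,v(u^2\pm v^2))$. Write $f_{33}(u,s)=s+us\,c_1(s)+u^2c_2(s)+u^3c_3(s)+u^4c_4(u,s)$ and $f_{32}(u,v,s)=u\,d_1(u,v,s)+v\,d_2(u,v,s)+s\,d_3(u,v,s)$ with smooth $c_i,d_i$, so that $c_2(0)=\frac12(f_{33})_{uu}(0,0)$, $c_3(0)=\frac16(f_{33})_{uuu}(0,0)$, $d_1(0,0,0)=(f_{32})_u(0,0,0)$; put $c_{20}=\sqrt{|c_2(0)|}$ (which is positive). Put $s=-\tilde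 s^2$ if $c_2(0)>0$ and $s=\tilde s^2$ if $c_2(0)<0$, and let $u(\tilde s)$ be a function, continuous at $0$ with $u(0)=0$, such that $(u(\tilde s),0)$ is a singular point of $f^{s}$ for all small $\tilde s$. Then for all small $\tilde s\neq0$ the germ of $f^{s}$ at $p=(u(\tilde s),0)$ has a Bruce--West normal form: there are a diffeomorphism-germ $\phi:(\mathbb R^2,0)\to(\mathbb R^2,p)$ and $T\in SO(3)$ with $$T\bigl(f^{s}(\phi(x,y))-f^{s}(p)\bigr)=\Bigl(x,\;xy+O(3),\;\tfrac12(a_{20}x^2+2a_{11}xy+a_{02}y^2)+O(3)\Bigr),\qquad a_{02}>0,$$ where $O(3)$ denotes terms of degree at least $3$. For any coefficients $a_{20}(\tilde s),a_{11}(\tilde s),a_{02}(\tilde s)$ so obtained, the following hold as $\tilde s\to0$, $\tilde s\ne0$ (and likewise as $\tilde s\to0^+$ and as $\tilde s\to0^-$): 1. $a_{20}(\tilde s)\to+\infty$ if and only if $f_{31}(0)\neq0$, and $a_{20}(\tilde s)$ is bounded if and only if $f_{31}(0)=0$. 2. $a_{11}(\tilde s)$ diverges, i.e. $|a_{11}(\tilde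 s)|\to\infty$, if and only if $f_{31}(0)\ne0$ or $2c_3(0)f_{31}(0)-c_{20}^2\bigl(3(f_{31})_u(0)-d_1(0,0,0)f_{21}(0)\bigr)\neq0$; and $a_{11}(\tilde s)$ is bounded if and only if $f_{31}(0)=3(f_{31})_u(0)-d_1(0,0,0)f_{21}(0)=0$. 3. $a_{02}(\tilde s)\to+\infty$. -/

import Mathlib

open Filter Topology Matrix
open scoped ContDiff

/-- The germ of `f` at `x` is of class `C^∞`: `f` is `C^∞` at all points near `x`. -/
def IsSmoothGerm {E F : Type*} [NormedAddCommGroup E] [NormedSpace ℝ E]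
    [NormedAddCommGroup F] [NormedSpace ℝ F] (f : E → F) (x : E) : Prop :=
  ∀ᶠ y in 𝓝 x, ContDiffAt ℝ ∞ f y

/-- `φ` is a diffeomorphism-germ `(E, x) → (F, y)`. -/
def IsDiffeoGerm {E F : Type*} [NormedAddCommGroup E] [NormedSpace ℝ E]
    [NormedAddCommGroup F] [NormedSpace ℝ F] (φ : E → F) (x : E) (y : F) : Prop :=
  φ x = y ∧ IsSmoothGerm φ x ∧
    ∃ χ : F → E, IsSmoothGerm χ y ∧ (∀ᶠ z in 𝓝 x, χ (φ z) = z) ∧ ∀ᶠ w in 𝓝 y, φ (χ w) = w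

/-- `𝒜`-equivalence of germs `(ℝ², 0) → (ℝ³, 0)`: `f₂ = ψ ∘ f₁ ∘ φ⁻¹` as germs, for
diffeomorphism-germs `φ` of `(ℝ², 0)` and `ψ` of `(ℝ³, 0)`. -/
def AEquivalent (f₁ f₂ : ℝ × ℝ → Fin 3 → ℝ) : Prop :=
  ∃ (φ : ℝ × ℝ → ℝ × ℝ) (ψ : (Fin 3 → ℝ) → Fin 3 → ℝ),
    IsDiffeoGerm φ 0 0 ∧ IsDiffeoGerm ψ 0 0 ∧ ∀ᶠ x in 𝓝 (0 : ℝ × ℝ), f₂ (φ x) = ψ (f₁ x)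

/-- `g` has an `S₁⁺` singularity at the origin. -/
def IsS1Plus (g : ℝ × ℝ → Fin 3 → ℝ) : Prop :=
  AEquivalent g fun x => ![x.1, x.2 ^ 2, x.2 * (x.1 ^ 2 + x.2 ^ 2)]

/-- `g` has an `S₁⁻` singularity at the origin. -/
def IsS1Minus (g : ℝ × ℝ → Fin 3 → ℝ) : Prop :=
  AEquivalent g fun x => ![x.1, x.2 ^ 2, x.2 * (x.1 ^ 2 - x.2 ^ 2)]

/-- The set of singular points of a map `ℝ² → ℝ³`: the points where its differential is not
injective. -/
def singularSet (f : ℝ × ℝ → Fin 3 → ℝ) : Set (ℝ × ℝ) :=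
  {p | ¬ Function.Injective (fderiv ℝ f p)}

/-- `a20, a11, a02` are the second order coefficients of the Bruce-West normal form of the germ
of `f` at `p`: for a diffeomorphism-germ `φ : (ℝ², 0) → (ℝ², p)` and a rotation `T`,
`T (f (φ (u, v)) - f p) = (u, uv + O(3), (a20 u² + 2 a11 uv + a02 v²) / 2 + O(3))`.
They are normalized by `0 < a02`; this can always be achieved at a Whitney umbrella, since the
rotation `diag (1, -1, -1)` together with `v ↦ -v` replaces `(a20, a11, a02)` by
`(-a20, a11, -a02)`. A germ that has this form with `a02 ≠ 0` is a Whitney umbrella. -/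
def IsBruceWest (f : ℝ × ℝ → Fin 3 → ℝ) (p : ℝ × ℝ) (a20 a11 a02 : ℝ) : Prop :=
  0 < a02 ∧ ∃ (φ : ℝ × ℝ → ℝ × ℝ) (T : Matrix (Fin 3) (Fin 3) ℝ),
    IsDiffeoGerm φ 0 p ∧ T ∈ Matrix.specialOrthogonalGroup (Fin 3) ℝ ∧
    (∀ᶠ x in 𝓝 (0 : ℝ × ℝ), (T *ᵥ (f (φ x) - f p)) 0 = x.1) ∧
    ((fun x : ℝ × ℝ => (T *ᵥ (f (φ x) - f p)) 1 - x.1 * x.2) =O[𝓝 0] fun x => ‖x‖ ^ 3) ∧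
    ((fun x : ℝ × ℝ => (T *ᵥ (f (φ x) - f p)) 2
        - (a20 * x.1 ^ 2 + 2 * a11 * (x.1 * x.2) + a02 * x.2 ^ 2) / 2)
      =O[𝓝 0] fun x => ‖x‖ ^ 3)

/-- The map `(u, v) ↦ (u, u² f21(u) + v² + u s f24(u, s),
u² f31(u) + v² f32(u, v, s) + v f33(u, s) + u s f34(u, s))`. -/
def normalForm (f21 f31 : ℝ → ℝ) (f24 f33 f34 : ℝ × ℝ → ℝ) (f32 : ℝ × ℝ × ℝ → ℝ) (s : ℝ)
    (x : ℝ × ℝ) : Fin 3 → ℝ :=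
  ![x.1,
    x.1 ^ 2 * f21 x.1 + x.2 ^ 2 + x.1 * s * f24 (x.1, s),
    x.1 ^ 2 * f31 x.1 + x.2 ^ 2 * f32 (x.1, x.2, s) + x.2 * f33 (x.1, s)
      + x.1 * s * f34 (x.1, s)]

/-- `f21, …, f34` are the coefficient functions of a normal form of a deformation of an `S₁⁺` or
`S₁⁻` singularity, normalized by `f33 (0, s) = s`. -/
structure IsS1NormalForm (f21 f31 : ℝ → ℝ) (f24 f33 f34 : ℝ × ℝ → ℝ)
    (f32 : ℝ × ℝ × ℝ → ℝ) : Prop where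
  smooth21 : IsSmoothGerm f21 0
  smooth31 : IsSmoothGerm f31 0
  smooth24 : IsSmoothGerm f24 0
  smooth33 : IsSmoothGerm f33 0
  smooth34 : IsSmoothGerm f34 0
  smooth32 : IsSmoothGerm f32 0
  f32_zero : f32 (0, 0, 0) = 0
  f33_axis : ∀ᶠ s in 𝓝 (0 : ℝ), f33 (0, s) = s
  f33_u : deriv (fun u => f33 (u, 0)) 0 = 0
  s1 : IsS1Plus (normalForm f21 f31 f24 f33 f34 f32 0) ∨
    IsS1Minus (normalForm f21 f31 f24 f33 f34 f32 0)

/-- The coefficient `c₂(0)` in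
`f33(u, s) = s + u s c₁(s) + u² c₂(s) + u³ c₃(s) + u⁴ c₄(u, s)`. -/
noncomputable def c2 (f33 : ℝ × ℝ → ℝ) : ℝ := iteratedDeriv 2 (fun u => f33 (u, 0)) 0 / 2

/-- The coefficient `c₃(0)` in
`f33(u, s) = s + u s c₁(s) + u² c₂(s) + u³ c₃(s) + u⁴ c₄(u, s)`. -/
noncomputable def c3 (f33 : ℝ × ℝ → ℝ) : ℝ := iteratedDeriv 3 (fun u => f33 (u, 0)) 0 / 6

/-- `c₂₀ > 0` with `c₂(0) = ± c₂₀²`. -/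
noncomputable def c20 (f33 : ℝ × ℝ → ℝ) : ℝ := √|c2 f33|

/-- The value `d₁(0, 0, 0)` in
`f32(u, v, s) = u d₁(u, v, s) + v d₂(u, v, s) + s d₃(u, v, s)`. -/
noncomputable def d1 (f32 : ℝ × ℝ × ℝ → ℝ) : ℝ := deriv (fun u => f32 (u, 0, 0)) 0

/-- The deformation parameter `s` as a function of `s̃`: `s = -s̃²` if `c₂(0) > 0`, and `s = s̃²`
if `c₂(0) < 0`. -/
noncomputable def deformParam (f33 : ℝ × ℝ → ℝ) (t : ℝ) : ℝ := -(Real.sign (c2 f33)) * t ^ 2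

/-- `a` is bounded along the filter `l`. -/
def BoundedAlong (l : Filter ℝ) (a : ℝ → ℝ) : Prop := ∃ M : ℝ, ∀ᶠ t in l, |a t| ≤ M

/-! At a point (u, 0) the 2-jet of f^s has the shape recorded by `HasUmbrellaJet`, with w =
f33(u,s), h = ∂_u f33(u,s), k = f32(u,0,s), and A, B, A', B' the first and second u-derivatives of
the parts of components 2 and 3 that do not involve v. The point is singular only if w = 0. When w =
0 and h ≠ 0 a normal form can be built by hand (`HasUmbrellaJet.exists_bruceWest`).

Conversely, `HasUmbrellaJet.bruceWest_eq` shows that the jet determines a02, a20 and |a11| for every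
normal form. Write e = kA' - B'. Up to factors tending to 1 and terms tending to 0, a02 is 2/h²,
|a11| is |e|/h², and a20 is A' + e²/(2h²).

It remains to expand h and e along the curve t ↦ (u, s). Being singular means f33(u,s) = 0, and
since f33(u,s) = s + O(2) this gives s = O(u²) (`isBigO_sq_of_zero`). Hence derivatives in s only
enter at order u². Also u ≠ 0 for t ≠ 0, because f33(0,s) = s. Then h = 2 c₂(0) u + O(u²) and e = -2
f31(0) - 2 (3 f31'(0) - d₁ f21(0)) u + O(u²).

The S₁ hypothesis is used to get c₂(0) ≠ 0 (`IsS1NormalForm.c2_ne_zero`), so that h is comparable to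
u. `bruceWest_limits` turns the expansions into the asymptotics: e₀ ≠ 0 makes a20 and a11 blow up,
e₀ = 0 ≠ e₁ only a11, and e = O(u²) keeps both bounded. The term with c₃ is irrelevant, since it
vanishes as soon as f31(0) does. -/

open Asymptotics

/-! ### Taylor estimates with remainders O(‖z‖ⁿ). -/

section Taylor

variable {E F : Type*} [NormedAddCommGroup E] [NormedSpace ℝ E]
  [NormedAddCommGroup F] [NormedSpace ℝ F]

/-- Mean value inequality on the closed ball of radius ‖z‖, where the derivative is at most C‖z‖ⁿ.
All Taylor estimates below come from it by integrating. -/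
theorem isBigO_norm_pow_succ_of_hasFDerivAt {g : E → F} {g' : E → E →L[ℝ] F} {n : ℕ}
    (hg : ∀ᶠ z in 𝓝 (0 : E), HasFDerivAt g (g' z) z) (h0 : g 0 = 0)
    (h : g' =O[𝓝 0] fun z => ‖z‖ ^ n) : g =O[𝓝 0] fun z => ‖z‖ ^ (n + 1) := by
  obtain ⟨C, hC⟩ := h.bound
  obtain ⟨δ, hδ, hb⟩ := Metric.eventually_nhds_iff_ball.1 (hg.and hC)
  refine IsBigO.of_bound C ?_
  filter_upwards [Metric.ball_mem_nhds (0 : E) hδ] with z hz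
  have hz' : ‖z‖ < δ := by simpa using hz
  have hsub : ∀ w ∈ Metric.closedBall (0 : E) ‖z‖, w ∈ Metric.ball (0 : E) δ := by
    intro w hw
    have : ‖w‖ ≤ ‖z‖ := by simpa using hw
    simpa using this.trans_lt hz'
  -- The big-O constant has no prescribed sign; a negative one is compatible with the bound only at
  -- z = 0.
  have hC0 : 0 ≤ C ∨ z = 0 := by
    by_contra hcon
    push Not at hcon
    have h1 := (hb z hz).2
    have h2 : 0 < ‖z‖ ^ n := pow_pos (norm_pos_iff.2 hcon.2) n
    have h3 : 0 ≤ ‖g' z‖ := norm_nonneg _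
    rw [Real.norm_of_nonneg h2.le] at h1
    nlinarith [mul_neg_of_neg_of_pos hcon.1 h2]
  rcases hC0 with hC0 | rfl
  · have key := (convex_closedBall (0 : E) ‖z‖).norm_image_sub_le_of_norm_hasFDerivWithin_le
      (f := g) (f' := g') (C := C * ‖z‖ ^ n) (x := 0) (y := z)
      (fun w hw => (hb w (hsub w hw)).1.hasFDerivWithinAt)
      (fun w hw => by
        have h1 := (hb w (hsub w hw)).2
        have hw' : ‖w‖ ≤ ‖z‖ := by simpa using hw
        rw [norm_pow, norm_norm] at h1
        exact h1.trans (by gcongr))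
      (by simp) (by simp)
    rw [norm_pow, norm_norm, pow_succ, ← mul_assoc]
    simpa [h0] using key
  · simp [h0]

theorem isBigO_norm_pow_succ_of_hasDerivAt {g g' : ℝ → ℝ} {n : ℕ}
    (hg : ∀ᶠ z in 𝓝 (0 : ℝ), HasDerivAt g (g' z) z) (h0 : g 0 = 0)
    (h : g' =O[𝓝 0] fun z => ‖z‖ ^ n) : g =O[𝓝 0] fun z => ‖z‖ ^ (n + 1) := by
  refine isBigO_norm_pow_succ_of_hasFDerivAt (hg.mono fun z hz => hz.hasFDerivAt) h0 ?_
  refine IsBigO.trans (IsBigO.of_bound 1 (Eventually.of_forall fun z => ?_)) h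
  simp

theorem ContDiffAt.isBigO_sub_fderiv {g : E → F} {p : E} (hg : ContDiffAt ℝ ∞ g p) :
    (fun z => g (p + z) - g p - fderiv ℝ g p z) =O[𝓝 0] fun z => ‖z‖ ^ 2 := by
  have hshift : Tendsto (fun z : E => p + z) (𝓝 0) (𝓝 p) :=
    Continuous.tendsto' (by fun_prop) _ _ (by simp)
  have hd : ∀ᶠ y in 𝓝 p, DifferentiableAt ℝ g y := by
    filter_upwards [(hg.of_le (m := 1) (by exact_mod_cast le_top)).eventually (by simp)] with y hy
    exact hy.differentiableAt (by simp)
  have h2 : DifferentiableAt ℝ (fderiv ℝ g) p :=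
    (hg.fderiv_right (m := ∞) (by simp)).differentiableAt (by simp)
  refine isBigO_norm_pow_succ_of_hasFDerivAt (n := 1)
    (g' := fun z => fderiv ℝ g (p + z) - fderiv ℝ g p) ?_ (by simp) ?_
  · filter_upwards [hshift.eventually hd] with z hz
    have h1 : HasFDerivAt (fun z => g (p + z)) (fderiv ℝ g (p + z)) z :=
      (hasFDerivAt_comp_add_left p).2 hz.hasFDerivAt
    exact (h1.sub_const (g p)).sub (fderiv ℝ g p).hasFDerivAt
  · have := h2.isBigO_sub.comp_tendsto hshift
    simpa [Function.comp_def] using this.norm_right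

/-- Differentiability of g₂ at the single point x bounds its increment by O(z); two integrations
then raise the order to 3. -/
theorem isBigO_taylor_two {g g₁ g₂ : ℝ → ℝ} {x : ℝ}
    (h₁ : ∀ᶠ y in 𝓝 x, HasDerivAt g (g₁ y) y) (h₂ : ∀ᶠ y in 𝓝 x, HasDerivAt g₁ (g₂ y) y)
    (h₃ : DifferentiableAt ℝ g₂ x) :
    (fun z => g (x + z) - g x - g₁ x * z - g₂ x / 2 * z ^ 2) =O[𝓝 0] fun z => ‖z‖ ^ 3 := by
  have hshift : Tendsto (fun z : ℝ => x + z) (𝓝 0) (𝓝 x) :=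
    Continuous.tendsto' (by fun_prop) _ _ (by simp)
  have hs : ∀ {f f' : ℝ → ℝ}, (∀ᶠ y in 𝓝 x, HasDerivAt f (f' y) y) →
      ∀ᶠ z in 𝓝 0, HasDerivAt (fun z => f (x + z)) (f' (x + z)) z := by
    intro f f' hf
    filter_upwards [hshift.eventually hf] with z hz
    exact hz.comp_const_add x z
  refine isBigO_norm_pow_succ_of_hasDerivAt (n := 2)
    (g' := fun z => g₁ (x + z) - g₁ x - g₂ x * z) ?_ (by simp) ?_
  · filter_upwards [hs h₁] with z hz
    have := ((hz.sub_const (g x)).sub ((hasDerivAt_id z).const_mul (g₁ x))).sub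
      ((hasDerivAt_pow 2 z).const_mul (g₂ x / 2))
    refine this.congr_deriv ?_
    norm_num
    ring
  refine isBigO_norm_pow_succ_of_hasDerivAt (n := 1)
    (g' := fun z => g₂ (x + z) - g₂ x) ?_ (by simp) ?_
  · filter_upwards [hs h₂] with z hz
    have := (hz.sub_const (g₁ x)).sub ((hasDerivAt_id z).const_mul (g₂ x))
    exact this.congr_deriv (by ring)
  · have := h₃.isBigO_sub.comp_tendsto hshift
    simpa [Function.comp_def] using this.norm_right

end Taylor

/-! ### Comparing coefficients of polynomials modulo higher order. -/

section Comparison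

theorem eq_zero_of_mul_isBigO_sq {c : ℝ} (h : (fun r : ℝ => c * r) =O[𝓝 0] fun r => r ^ 2) :
    c = 0 := by
  by_contra hc
  have h1 : (fun r : ℝ => r ^ 2) =o[𝓝 0] fun r => r := by
    simpa using isLittleO_pow_pow (𝕜 := ℝ) one_lt_two
  have h2 : (fun r : ℝ => r) =o[𝓝 0] fun r => r :=
    (isLittleO_const_mul_left_iff hc).1 (h.trans_isLittleO h1)
  have h3 : ∀ᶠ r in 𝓝[≠] (0 : ℝ), r ≠ 0 := self_mem_nhdsWithin
  exact (h2.mono nhdsWithin_le_nhds).not_isBigO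
    (h3.frequently) (isBigO_refl _ _)

theorem eq_zero_of_quadratic_isBigO_cube {c q : ℝ}
    (h : (fun r : ℝ => c * r + q * r ^ 2) =O[𝓝 0] fun r => r ^ 3) : c = 0 ∧ q = 0 := by
  have h32 : (fun r : ℝ => r ^ 3) =O[𝓝 0] fun r => r ^ 2 :=
    (isLittleO_pow_pow (𝕜 := ℝ) (show 2 < 3 by norm_num)).isBigO
  have hc : c = 0 := by
    refine eq_zero_of_mul_isBigO_sq ?_
    have := (h.trans h32).sub ((isBigO_refl (fun r : ℝ => r ^ 2) (𝓝 0)).const_mul_left q)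
    simpa using this
  subst hc
  refine ⟨rfl, ?_⟩
  by_contra hq
  have h1 : (fun r : ℝ => r ^ 3) =o[𝓝 0] fun r => r ^ 2 :=
    isLittleO_pow_pow (𝕜 := ℝ) (by norm_num)
  have h2 : (fun r : ℝ => r ^ 2) =o[𝓝 0] fun r => r ^ 2 :=
    (isLittleO_const_mul_left_iff hq).1 (by simpa using h.trans_isLittleO h1)
  have h3 : ∀ᶠ r in 𝓝[≠] (0 : ℝ), r ^ 2 ≠ 0 := by
    filter_upwards [self_mem_nhdsWithin] with r hr
    exact pow_ne_zero 2 hr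
  exact (h2.mono nhdsWithin_le_nhds).not_isBigO h3.frequently (isBigO_refl _ _)

theorem tendsto_line (a b : ℝ) :
    Tendsto (fun r : ℝ => ((r * a, r * b) : ℝ × ℝ)) (𝓝 0) (𝓝 0) :=
  Continuous.tendsto' (by fun_prop) _ _ (by simp)

theorem isBigO_norm_line_pow (a b : ℝ) (n : ℕ) :
    (fun r : ℝ => ‖((r * a, r * b) : ℝ × ℝ)‖ ^ n) =O[𝓝 0] fun r => r ^ n := by
  refine IsBigO.pow (IsBigO.of_bound ‖((a, b) : ℝ × ℝ)‖ (Eventually.of_forall fun r => ?_)) n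
  have h : ((r * a, r * b) : ℝ × ℝ) = r • (a, b) := rfl
  rw [norm_norm, h, norm_smul, mul_comm]

/-- A linear form on the plane that is `O(‖x‖²)` vanishes. -/
theorem linear_eq_zero_of_isBigO {c₁ c₂ : ℝ}
    (h : (fun x : ℝ × ℝ => c₁ * x.1 + c₂ * x.2) =O[𝓝 0] fun x => ‖x‖ ^ 2) :
    c₁ = 0 ∧ c₂ = 0 := by
  have key : ∀ a b : ℝ, c₁ * a + c₂ * b = 0 := fun a b => by
    refine eq_zero_of_mul_isBigO_sq ?_
    refine IsBigO.congr_left ((h.comp_tendsto (tendsto_line a b)).trans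
      (isBigO_norm_line_pow a b 2)) fun r => ?_
    simp only [Function.comp_apply]
    ring
  constructor
  · simpa using key 1 0
  · simpa using key 0 1

/-- A quadratic form on the plane that is `O(‖x‖³)` vanishes. -/
theorem quadratic_eq_zero_of_isBigO {q₁ q₂ q₃ : ℝ}
    (h : (fun x : ℝ × ℝ => q₁ * x.1 ^ 2 + q₂ * (x.1 * x.2) + q₃ * x.2 ^ 2)
      =O[𝓝 0] fun x => ‖x‖ ^ 3) :
    q₁ = 0 ∧ q₂ = 0 ∧ q₃ = 0 := by
  -- Restriction to the line through (a, b) reduces to one variable; the directions (1,0), (0,1),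
  -- (1,1) recover the three coefficients.
  have key : ∀ a b : ℝ, q₁ * a ^ 2 + q₂ * (a * b) + q₃ * b ^ 2 = 0 := fun a b => by
    refine (eq_zero_of_quadratic_isBigO_cube (c := 0) ?_).2
    refine IsBigO.congr_left ((h.comp_tendsto (tendsto_line a b)).trans
      (isBigO_norm_line_pow a b 3)) fun r => ?_
    simp only [Function.comp_apply]
    ring
  have h1 : q₁ = 0 := by simpa using key 1 0
  have h3 : q₃ = 0 := by simpa using key 0 1
  refine ⟨h1, ?_, h3⟩
  have := key 1 1
  rw [h1, h3] at this
  simpa using this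

end Comparison

/-! ### Umbrella jets determine the Bruce–West coefficients. -/

/-- The germ of `f` at `p` is, after subtracting `f p` and up to terms of order three,
`(u, v) ↦ (u, A u + A' u² / 2 + v², B u + w v + B' u² / 2 + h u v + k v²)`. -/
structure HasUmbrellaJet (f : ℝ × ℝ → Fin 3 → ℝ) (p : ℝ × ℝ) (A B A' B' k h w : ℝ) : Prop where
  fst : ∀ z : ℝ × ℝ, f (p + z) 0 - f p 0 = z.1
  snd : (fun z : ℝ × ℝ => f (p + z) 1 - f p 1 - (A * z.1 + A' / 2 * z.1 ^ 2 + z.2 ^ 2))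
    =O[𝓝 0] fun z => ‖z‖ ^ 3
  trd : (fun z : ℝ × ℝ => f (p + z) 2 - f p 2
      - (B * z.1 + w * z.2 + B' / 2 * z.1 ^ 2 + h * (z.1 * z.2) + k * z.2 ^ 2))
    =O[𝓝 0] fun z => ‖z‖ ^ 3

theorem isBigO_fst_norm : (fun z : ℝ × ℝ => z.1) =O[𝓝 0] fun z => ‖z‖ :=
  IsBigO.of_bound 1 (Eventually.of_forall fun z => by simpa using norm_fst_le z)

theorem isBigO_snd_norm : (fun z : ℝ × ℝ => z.2) =O[𝓝 0] fun z => ‖z‖ :=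
  IsBigO.of_bound 1 (Eventually.of_forall fun z => by simpa using norm_snd_le z)

theorem isBigO_quadratic (q₁ q₂ q₃ : ℝ) :
    (fun z : ℝ × ℝ => q₁ * z.1 ^ 2 + q₂ * (z.1 * z.2) + q₃ * z.2 ^ 2)
      =O[𝓝 0] fun z => ‖z‖ ^ 2 := by
  refine (((isBigO_fst_norm.pow 2).const_mul_left _).add (IsBigO.const_mul_left ?_ _)).add
    ((isBigO_snd_norm.pow 2).const_mul_left _)
  simpa [pow_two] using isBigO_fst_norm.mul isBigO_snd_norm

theorem isBigO_norm_cube_sq {E : Type*} [NormedAddCommGroup E] :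
    (fun z : E => ‖z‖ ^ 3) =O[𝓝 0] fun z => ‖z‖ ^ 2 := by
  refine IsBigO.of_bound 1 ?_
  filter_upwards [Metric.ball_mem_nhds (0 : E) one_pos] with z hz
  have hz' : ‖z‖ < 1 := by simpa using hz
  rw [norm_pow, norm_pow, norm_norm, one_mul]
  exact pow_le_pow_of_le_one (norm_nonneg _) hz'.le (by norm_num)

/-- A product changes by `O(‖x‖³)` if its factors, both `O(‖x‖)`, change by `O(‖x‖²)`. -/
theorem isBigO_mul_sub_mul {E : Type*} [NormedAddCommGroup E] {f g f₀ g₀ : E → ℝ}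
    (hf : (fun x => f x - f₀ x) =O[𝓝 0] fun x => ‖x‖ ^ 2)
    (hg : (fun x => g x - g₀ x) =O[𝓝 0] fun x => ‖x‖ ^ 2)
    (hf₁ : f =O[𝓝 0] fun x => ‖x‖) (hg₀ : g₀ =O[𝓝 0] fun x => ‖x‖) :
    (fun x => f x * g x - f₀ x * g₀ x) =O[𝓝 0] fun x => ‖x‖ ^ 3 := by
  have h1 : (fun x => f x * (g x - g₀ x)) =O[𝓝 0] fun x => ‖x‖ ^ 3 :=
    (hf₁.mul hg).congr_right fun x => by ring
  have h2 : (fun x => (f x - f₀ x) * g₀ x) =O[𝓝 0] fun x => ‖x‖ ^ 3 :=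
    (hf.mul hg₀).congr_right fun x => by ring
  exact (h1.add h2).congr_left fun x => by ring

theorem HasUmbrellaJet.mulVec_apply {f : ℝ × ℝ → Fin 3 → ℝ} {p : ℝ × ℝ}
    {A B A' B' k h : ℝ} (hf : HasUmbrellaJet f p A B A' B' k h 0)
    (T : Matrix (Fin 3) (Fin 3) ℝ) (i : Fin 3) :
    (fun z : ℝ × ℝ => (T *ᵥ (f (p + z) - f p)) i - ((T i 0 + T i 1 * A + T i 2 * B) * z.1
      + ((T i 1 * A' + T i 2 * B') / 2 * z.1 ^ 2 + T i 2 * h * (z.1 * z.2)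
        + (T i 1 + T i 2 * k) * z.2 ^ 2))) =O[𝓝 0] fun z => ‖z‖ ^ 3 := by
  refine ((hf.snd.const_mul_left (T i 1)).add (hf.trd.const_mul_left (T i 2))).congr_left
    fun z => ?_
  have := hf.fst z
  simp only [mulVec, dotProduct, Fin.sum_univ_three, Pi.sub_apply, this]
  ring

/-- Solving the equations between the coefficients of an umbrella jet and of a Bruce-West normal
form: `T` is the rotation, and `(x, y) ↦ (α x, γ x + β y)` the derivative of the coordinate
change. -/
theorem bruceWest_coefficients {T : Matrix (Fin 3) (Fin 3) ℝ}
    (hT : T ∈ Matrix.specialOrthogonalGroup (Fin 3) ℝ)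
    {A B A' B' k h α β γ a20 a11 a02 : ℝ} (ha : 0 < a02)
    (t0 : (T 0 0 + T 0 1 * A + T 0 2 * B) * α = 1)
    (t1 : T 1 0 + T 1 1 * A + T 1 2 * B = 0) (t2 : T 2 0 + T 2 1 * A + T 2 2 * B = 0)
    (g1 : T 1 1 + T 1 2 * k = 0) (h1 : T 1 2 * h * (α * β) = 1)
    (f1 : (T 1 1 * A' + T 1 2 * B') / 2 * α + T 1 2 * h * γ = 0)
    (e02 : a02 = 2 * (T 2 1 + T 2 2 * k) * β ^ 2)
    (e11 : a11 = T 2 2 * h * (α * β) + 2 * (T 2 1 + T 2 2 * k) * (β * γ))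
    (e20 : a20 = (T 2 1 * A' + T 2 2 * B') * α ^ 2 + 2 * (T 2 2 * h) * (α * γ)
      + 2 * (T 2 1 + T 2 2 * k) * γ ^ 2) :
    a02 = 2 * √(1 + A ^ 2 + B ^ 2) * √(1 + k ^ 2 + (B - k * A) ^ 2) ^ 3 / h ^ 2 ∧
    a20 = ((1 + B * (B - k * A)) * A' + (k - A * (B - k * A)) * (k * A')
        + (1 + k ^ 2 + (B - k * A) ^ 2) * (k * A' - B') ^ 2 / (2 * h ^ 2)) /
        ((1 + A ^ 2 + B ^ 2) * √(1 + A ^ 2 + B ^ 2) * √(1 + k ^ 2 + (B - k * A) ^ 2)) ∧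
    |a11| = |k - A * (B - k * A)
        + (1 + k ^ 2 + (B - k * A) ^ 2) * (k * A' - B') / h ^ 2| / √(1 + A ^ 2 + B ^ 2) := by
  obtain ⟨hTo, -⟩ := Matrix.mem_specialOrthogonalGroup_iff.1 hT
  have hrow := (Matrix.mem_orthogonalGroup_iff _ _).1 hTo
  have hcol := (Matrix.mem_orthogonalGroup_iff' _ _).1 hTo
  have r11 := congrFun (congrFun hrow 1) 1
  have r22 := congrFun (congrFun hrow 2) 2
  have r21 := congrFun (congrFun hrow 2) 1
  have q00 := congrFun (congrFun hcol 0) 0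
  have q01 := congrFun (congrFun hcol 0) 1
  have q02 := congrFun (congrFun hcol 0) 2
  have q11 := congrFun (congrFun hcol 1) 1
  have q12 := congrFun (congrFun hcol 1) 2
  have q22 := congrFun (congrFun hcol 2) 2
  simp [Matrix.mul_apply, Fin.sum_univ_three] at r11 r22 r21 q00 q01 q02 q11 q12 q22
  clear hrow hcol hTo hT
  generalize T 0 0 = T00 at *
  generalize T 0 1 = T01 at *
  generalize T 0 2 = T02 at *
  generalize T 1 0 = T10 at *
  generalize T 1 1 = T11 at *
  generalize T 1 2 = m at *
  generalize T 2 0 = T20 at *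
  generalize T 2 1 = T21 at *
  generalize T 2 2 = T22 at *
  have hN : 0 < 1 + A ^ 2 + B ^ 2 := by positivity
  have hM : 0 < 1 + k ^ 2 + (B - k * A) ^ 2 := by positivity
  -- Put X = (1, A, B). The squares of the products of X with the rows of `T` sum to |X|² = N, and
  -- by `t1`, `t2` only row 0 contributes.
  have hαN : α ^ 2 * (1 + A ^ 2 + B ^ 2) = 1 := by
    have hτ : (T00 + T01 * A + T02 * B) ^ 2 = 1 + A ^ 2 + B ^ 2 := by
      linear_combination q00 + 2 * A * q01 + 2 * B * q02 + A ^ 2 * q11 + 2 * A * B * q12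
        + B ^ 2 * q22 - (T10 + T11 * A + m * B) * t1 - (T20 + T21 * A + T22 * B) * t2
    rw [← hτ, ← mul_pow, mul_comm, t0, one_pow]
  -- Row 1 is orthogonal to X and to (0, 1, k), so it is -m Y with Y = (B - kA, k, -1) and |Y|² = M.
  obtain rfl : T11 = -(m * k) := by linarith
  obtain rfl : T10 = m * (k * A - B) := by linarith
  have hmM : m ^ 2 * (1 + k ^ 2 + (B - k * A) ^ 2) = 1 := by linear_combination r11
  have hm : m ≠ 0 := by rintro rfl; simp at hmM
  have hh : h ≠ 0 := by rintro rfl; simp at h1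
  have hα : α ≠ 0 := by rintro rfl; simp at h1
  have hY : T20 * (B - k * A) + T21 * k - T22 = 0 := by
    refine (mul_eq_zero.1 (?_ : m * _ = 0)).resolve_left hm
    linear_combination -r21
  set N := 1 + A ^ 2 + B ^ 2 with hNdef
  set M := 1 + k ^ 2 + (B - k * A) ^ 2 with hMdef
  -- Row 2 is orthogonal to X and Y, hence a multiple of X × Y, whose squared length is NM; n is
  -- that multiple.
  obtain ⟨n, hn⟩ : ∃ n, n = (T20 * (-A - B * k) + T21 * (1 + B * (B - k * A))
    + T22 * (k - A * (B - k * A))) / (N * M) := ⟨_, rfl⟩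
  have hn' : n * (N * M) = T20 * (-A - B * k) + T21 * (1 + B * (B - k * A))
    + T22 * (k - A * (B - k * A)) := by rw [hn]; field_simp
  have hNM : N * M ≠ 0 := by positivity
  have h20 : T20 = n * (-A - B * k) := by
    refine mul_left_cancel₀ hNM ?_
    linear_combination M * t2 + N * (B - k * A) * hY - (-A - B * k) * hn'
  have h21 : T21 = n * (1 + B * (B - k * A)) := by
    refine mul_left_cancel₀ hNM ?_
    linear_combination M * A * t2 + N * k * hY - (1 + B * (B - k * A)) * hn'
  have h22 : T22 = n * (k - A * (B - k * A)) := by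
    refine mul_left_cancel₀ hNM ?_
    linear_combination M * B * t2 - N * hY - (k - A * (B - k * A)) * hn'
  have hnNM : n ^ 2 * (N * M) = 1 := by
    rw [h20, h21, h22] at r22
    linear_combination r22
  have hG : T21 + T22 * k = n * M := by rw [h21, h22]; ring
  have hβ : β = 1 / (m * h * α) := by field_simp; linear_combination h1
  have hγ : γ = α * (k * A' - B') / (2 * h) := by
    have : m * (2 * h * γ) = m * (α * (k * A' - B')) := by linear_combination 2 * f1
    have := mul_left_cancel₀ hm this
    field_simp
    linear_combination this
  have hβ0 : β ≠ 0 := by rintro rfl; simp at h1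
  -- The normalization a02 > 0 fixes the sign of n.
  have hnpos : 0 < n := by
    rw [e02, hG] at ha
    have : 0 < n * (M * β ^ 2) := by linarith
    exact pos_of_mul_pos_left this (by positivity)
  have hSN : √N ^ 2 = N := Real.sq_sqrt hN.le
  have hSM : √M ^ 2 = M := Real.sq_sqrt hM.le
  have hSN0 : 0 < √N := Real.sqrt_pos.2 hN
  have hSM0 : 0 < √M := Real.sqrt_pos.2 hM
  have hnS : n * (√N * √M) = 1 := by
    have h2 : (n * (√N * √M)) ^ 2 = 1 := by rw [mul_pow, mul_pow, hSN, hSM, hnNM]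
    exact (pow_eq_one_iff_of_nonneg (by positivity) two_ne_zero).1 h2
  have hn1 : n = 1 / (√N * √M) := by field_simp; linear_combination hnS
  have hα2 : α ^ 2 = 1 / √N ^ 2 := by rw [hSN]; field_simp; linear_combination hαN
  have hm2 : m ^ 2 = 1 / √M ^ 2 := by rw [hSM]; field_simp; linear_combination hmM
  have hmS : |m| = 1 / √M := by
    rw [← Real.sqrt_sq_eq_abs, hm2, ← _root_.one_div_pow, Real.sqrt_sq (by positivity)]
  clear_value N M
  refine ⟨?_, ?_, ?_⟩
  · rw [e02, hG, hβ, div_pow, mul_pow, mul_pow, hα2, hm2, hn1, ← hSM]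
    simp only [Real.sqrt_sq hSM0.le]
    field_simp
  · rw [e20, hG, hγ, h21, h22]
    have : (n * (1 + B * (B - k * A)) * A' + n * (k - A * (B - k * A)) * B') * α ^ 2
        + 2 * (n * (k - A * (B - k * A)) * h) * (α * (α * (k * A' - B') / (2 * h)))
        + 2 * (n * M) * (α * (k * A' - B') / (2 * h)) ^ 2
      = n * α ^ 2 * ((1 + B * (B - k * A)) * A' + (k - A * (B - k * A)) * (k * A')
        + M * (k * A' - B') ^ 2 / (2 * h ^ 2)) := by field_simp; ring
    rw [this, hα2, hn1, hSN]
    field_simp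
  -- The sign of m stays free, hence the absolute value. The ambiguity is genuine: diag(-1, -1, 1)
  -- together with x ↦ -x replaces a11 by -a11 and preserves a20 and a02.
  · have : a11 = n / m * (k - A * (B - k * A) + M * (k * A' - B') / h ^ 2) := by
      rw [e11, hG, hγ, hβ, h22]
      field_simp
    rw [this, abs_mul, abs_div, hmS, abs_of_pos hnpos, hn1]
    field_simp

/-- The second order coefficients of a Bruce-West normal form are determined by the jet. -/
theorem HasUmbrellaJet.bruceWest_eq {f : ℝ × ℝ → Fin 3 → ℝ} {p : ℝ × ℝ}
    {A B A' B' k h a20 a11 a02 : ℝ} (hf : HasUmbrellaJet f p A B A' B' k h 0)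
    (hb : IsBruceWest f p a20 a11 a02) :
    a02 = 2 * √(1 + A ^ 2 + B ^ 2) * √(1 + k ^ 2 + (B - k * A) ^ 2) ^ 3 / h ^ 2 ∧
    a20 = ((1 + B * (B - k * A)) * A' + (k - A * (B - k * A)) * (k * A')
        + (1 + k ^ 2 + (B - k * A) ^ 2) * (k * A' - B') ^ 2 / (2 * h ^ 2)) /
        ((1 + A ^ 2 + B ^ 2) * √(1 + A ^ 2 + B ^ 2) * √(1 + k ^ 2 + (B - k * A) ^ 2)) ∧
    |a11| = |k - A * (B - k * A)
        + (1 + k ^ 2 + (B - k * A) ^ 2) * (k * A' - B') / h ^ 2| / √(1 + A ^ 2 + B ^ 2) := by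
  obtain ⟨ha, φ, T, ⟨hφ0, hφs, -⟩, hT, hb0, hb1, hb2⟩ := hb
  have hφ : ContDiffAt ℝ ∞ φ 0 := hφs.self_of_nhds
  obtain ⟨L, hL⟩ : ∃ L, L = fderiv ℝ φ 0 := ⟨_, rfl⟩
  have hLxy : ∀ x : ℝ × ℝ, L x = x.1 • L (1, 0) + x.2 • L (0, 1) := fun x => by
    rw [← map_smul, ← map_smul, ← map_add]
    simp
  obtain ⟨z, hz⟩ : ∃ z : ℝ × ℝ → ℝ × ℝ, z = fun x => φ x - p := ⟨_, rfl⟩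
  have hφz : ∀ x, φ x = p + z x := fun x => by simp [hz]
  have hzL : (fun x => z x - L x) =O[𝓝 0] fun x => ‖x‖ ^ 2 := by
    refine hφ.isBigO_sub_fderiv.congr_left fun x => ?_
    rw [hz, hL]
    simp [hφ0]
  obtain ⟨α, hα⟩ : ∃ α, α = (L (1, 0)).1 := ⟨_, rfl⟩
  obtain ⟨δ, hδ⟩ : ∃ δ, δ = (L (0, 1)).1 := ⟨_, rfl⟩
  obtain ⟨γ, hγ⟩ : ∃ γ, γ = (L (1, 0)).2 := ⟨_, rfl⟩
  obtain ⟨β, hβ⟩ : ∃ β, β = (L (0, 1)).2 := ⟨_, rfl⟩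
  have hz1 : (fun x => (z x).1 - (α * x.1 + δ * x.2)) =O[𝓝 0] fun x => ‖x‖ ^ 2 := by
    refine (IsBigO.of_bound 1 (Eventually.of_forall fun x => ?_) :
      _ =O[𝓝 0] fun x => z x - L x).trans hzL
    rw [one_mul, hα, hδ]
    refine le_trans (le_of_eq ?_) (norm_fst_le (z x - L x))
    rw [hLxy x]
    simp [mul_comm]
  have hz2 : (fun x => (z x).2 - (γ * x.1 + β * x.2)) =O[𝓝 0] fun x => ‖x‖ ^ 2 := by
    refine (IsBigO.of_bound 1 (Eventually.of_forall fun x => ?_) :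
      _ =O[𝓝 0] fun x => z x - L x).trans hzL
    rw [one_mul, hβ, hγ]
    refine le_trans (le_of_eq ?_) (norm_snd_le (z x - L x))
    rw [hLxy x]
    simp [mul_comm]
  have hz0 : Tendsto z (𝓝 0) (𝓝 0) := by
    have : Tendsto z (𝓝 0) (𝓝 (φ 0 - p)) := by
      rw [hz]
      exact (hφ.continuousAt.sub continuousAt_const)
    simpa [hφ0] using this
  have hzO : z =O[𝓝 0] fun x => ‖x‖ := by
    have := (hφ.differentiableAt (by simp)).isBigO_sub
    rw [hz]
    simpa [hφ0] using this.norm_right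
  have hjet : ∀ i, (fun x => (T *ᵥ (f (φ x) - f p)) i
      - ((T i 0 + T i 1 * A + T i 2 * B) * (z x).1
      + ((T i 1 * A' + T i 2 * B') / 2 * (z x).1 ^ 2 + T i 2 * h * ((z x).1 * (z x).2)
        + (T i 1 + T i 2 * k) * (z x).2 ^ 2))) =O[𝓝 0] fun x => ‖x‖ ^ 3 := fun i => by
    refine (((hf.mulVec_apply T i).comp_tendsto hz0).trans (hzO.norm_left.pow 3)).congr_left
      fun x => ?_
    simp [hφz]
  have hlin : ∀ i, (fun x => (T *ᵥ (f (φ x) - f p)) i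
      - (T i 0 + T i 1 * A + T i 2 * B) * (α * x.1 + δ * x.2)) =O[𝓝 0] fun x => ‖x‖ ^ 2 := by
    intro i
    have h1 := (hjet i).trans isBigO_norm_cube_sq
    have h2 := ((isBigO_quadratic ((T i 1 * A' + T i 2 * B') / 2) (T i 2 * h)
      (T i 1 + T i 2 * k)).comp_tendsto hz0).trans (hzO.norm_left.pow 2)
    have h3 := hz1.const_mul_left (T i 0 + T i 1 * A + T i 2 * B)
    refine ((h1.add h2).add h3).congr_left fun x => ?_
    simp only [Function.comp_apply]
    ring
  -- linear terms
  have l0 : (T 0 0 + T 0 1 * A + T 0 2 * B) * α = 1 ∧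
      (T 0 0 + T 0 1 * A + T 0 2 * B) * δ = 0 := by
    have : (fun x : ℝ × ℝ => (1 - (T 0 0 + T 0 1 * A + T 0 2 * B) * α) * x.1
        + (-((T 0 0 + T 0 1 * A + T 0 2 * B) * δ)) * x.2) =O[𝓝 0] fun x => ‖x‖ ^ 2 := by
      refine (hlin 0).congr' ?_ EventuallyEq.rfl
      filter_upwards [hb0] with x hx
      rw [hx]
      ring
    obtain ⟨h1, h2⟩ := linear_eq_zero_of_isBigO this
    exact ⟨by linarith, by linarith⟩
  -- The first component being exactly x makes the linear part of φ lower triangular.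
  have hδ0 : δ = 0 := by
    have h1 : T 0 0 + T 0 1 * A + T 0 2 * B ≠ 0 := by
      intro h0
      have := l0.1
      rw [h0] at this
      simp at this
    exact (mul_eq_zero.1 l0.2).resolve_left h1
  subst hδ0
  have hα0 : α ≠ 0 := by
    intro h0
    have := l0.1
    rw [h0] at this
    simp at this
  have hlin0 : ∀ i, ∀ q₁ q₂ q₃ : ℝ, ((fun x => (T *ᵥ (f (φ x) - f p)) i
      - (q₁ * x.1 ^ 2 + q₂ * (x.1 * x.2) + q₃ * x.2 ^ 2)) =O[𝓝 0] fun x => ‖x‖ ^ 3) →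
      T i 0 + T i 1 * A + T i 2 * B = 0 := by
    intro i q₁ q₂ q₃ hq
    have h1 := ((hq.trans isBigO_norm_cube_sq).add (isBigO_quadratic q₁ q₂ q₃)).sub (hlin i)
    have h2 : (fun x : ℝ × ℝ => ((T i 0 + T i 1 * A + T i 2 * B) * α) * x.1 + 0 * x.2)
        =O[𝓝 0] fun x => ‖x‖ ^ 2 := h1.congr_left fun x => by ring
    exact (mul_eq_zero.1 (linear_eq_zero_of_isBigO h2).1).resolve_right hα0
  -- quadratic terms
  have hO1 : (fun x => (z x).1) =O[𝓝 0] fun x => ‖x‖ :=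
    (isBigO_fst_norm.comp_tendsto hz0).trans hzO.norm_left
  have hO2 : (fun x => (z x).2) =O[𝓝 0] fun x => ‖x‖ :=
    (isBigO_snd_norm.comp_tendsto hz0).trans hzO.norm_left
  have hl1 : (fun x : ℝ × ℝ => α * x.1 + 0 * x.2) =O[𝓝 0] fun x => ‖x‖ :=
    (isBigO_fst_norm.const_mul_left _).add (isBigO_snd_norm.const_mul_left _)
  have hl2 : (fun x : ℝ × ℝ => γ * x.1 + β * x.2) =O[𝓝 0] fun x => ‖x‖ :=
    (isBigO_fst_norm.const_mul_left _).add (isBigO_snd_norm.const_mul_left _)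
  have hquad : ∀ i, ∀ q₁ q₂ q₃ : ℝ, ((fun x => (T *ᵥ (f (φ x) - f p)) i
      - (q₁ * x.1 ^ 2 + q₂ * (x.1 * x.2) + q₃ * x.2 ^ 2)) =O[𝓝 0] fun x => ‖x‖ ^ 3) →
      q₁ = (T i 1 * A' + T i 2 * B') / 2 * α ^ 2 + T i 2 * h * (α * γ)
        + (T i 1 + T i 2 * k) * γ ^ 2 ∧
      q₂ = T i 2 * h * (α * β) + 2 * (T i 1 + T i 2 * k) * (β * γ) ∧
      q₃ = (T i 1 + T i 2 * k) * β ^ 2 := by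
    intro i q₁ q₂ q₃ hq
    have hτ := hlin0 i q₁ q₂ q₃ hq
    -- In the quadratic part of the jet, φ may be replaced by its linear part at the cost of O(3).
    -- Second derivatives of φ could enter only through the linear term, which `hτ` removes.
    have h1 := (((isBigO_mul_sub_mul hz1 hz1 hO1 hl1).const_mul_left
        ((T i 1 * A' + T i 2 * B') / 2)).add
      ((isBigO_mul_sub_mul hz1 hz2 hO1 hl2).const_mul_left (T i 2 * h))).add
      ((isBigO_mul_sub_mul hz2 hz2 hO2 hl2).const_mul_left (T i 1 + T i 2 * k))
    have h2 := ((hjet i).sub hq).add h1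
    have h3 : (fun x : ℝ × ℝ => (q₁ - ((T i 1 * A' + T i 2 * B') / 2 * α ^ 2
        + T i 2 * h * (α * γ) + (T i 1 + T i 2 * k) * γ ^ 2)) * x.1 ^ 2
        + (q₂ - (T i 2 * h * (α * β) + 2 * (T i 1 + T i 2 * k) * (β * γ))) * (x.1 * x.2)
        + (q₃ - (T i 1 + T i 2 * k) * β ^ 2) * x.2 ^ 2) =O[𝓝 0] fun x => ‖x‖ ^ 3 :=
      h2.congr_left fun x => by rw [hτ]; ring
    obtain ⟨h4, h5, h6⟩ := quadratic_eq_zero_of_isBigO h3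
    exact ⟨by linarith, by linarith, by linarith⟩
  have hb1' := hb1.congr_left (f₂ := fun x => (T *ᵥ (f (φ x) - f p)) 1
    - (0 * x.1 ^ 2 + 1 * (x.1 * x.2) + 0 * x.2 ^ 2)) fun x => by ring
  have hb2' := hb2.congr_left (f₂ := fun x => (T *ᵥ (f (φ x) - f p)) 2
    - (a20 / 2 * x.1 ^ 2 + a11 * (x.1 * x.2) + a02 / 2 * x.2 ^ 2)) fun x => by ring
  obtain ⟨p1, p2, p3⟩ := hquad 1 _ _ _ hb1'
  obtain ⟨s1, s2, s3⟩ := hquad 2 _ _ _ hb2'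
  have hβ0 : β ≠ 0 := by
    rintro h0
    rw [h0] at s3
    simp at s3
    linarith
  have g1 : T 1 1 + T 1 2 * k = 0 := (mul_eq_zero.1 p3.symm).resolve_right (pow_ne_zero 2 hβ0)
  rw [g1] at p1 p2
  refine bruceWest_coefficients hT (α := α) (β := β) (γ := γ) ha l0.1 (hlin0 1 _ _ _ hb1')
    (hlin0 2 _ _ _ hb2') g1 (by linarith) ?_ (by linarith) s2 (by linarith)
  refine mul_left_cancel₀ hα0 ?_
  linarith

/-! ### Existence of a Bruce–West form. -/

theorem hasFDerivAt_of_isBigO_sq {E F : Type*} [NormedAddCommGroup E] [NormedSpace ℝ E]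
    [NormedAddCommGroup F] [NormedSpace ℝ F] {g : E → F} {L : E →L[ℝ] F} {p : E}
    (h : (fun z => g (p + z) - g p - L z) =O[𝓝 0] fun z => ‖z‖ ^ 2) : HasFDerivAt g L p := by
  rw [hasFDerivAt_iff_isLittleO_nhds_zero]
  exact h.trans_isLittleO (isLittleO_norm_pow_id one_lt_two)

/-- A smooth germ with invertible derivative has an inverse diffeomorphism-germ. -/
theorem IsSmoothGerm.exists_inverse {E F : Type*} [NormedAddCommGroup E] [NormedSpace ℝ E]
    [NormedAddCommGroup F] [NormedSpace ℝ F] [CompleteSpace E] {Φ : E → F} {p : E}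
    (hs : IsSmoothGerm Φ p) {e : E ≃L[ℝ] F} (he : HasFDerivAt Φ (e : E →L[ℝ] F) p) :
    ∃ φ : F → E, IsDiffeoGerm φ (Φ p) p ∧ ∀ᶠ y in 𝓝 (Φ p), Φ (φ y) = y := by
  have hp : ContDiffAt ℝ ∞ Φ p := hs.self_of_nhds
  have hn : (∞ : WithTop ℕ∞) ≠ 0 := by simp
  let H := hp.toOpenPartialHomeomorph Φ he hn
  have hH : ∀ x, H x = Φ x := fun x => rfl
  have hps : p ∈ H.source := hp.mem_toOpenPartialHomeomorph_source he hn
  have hpt : Φ p ∈ H.target := hp.image_mem_toOpenPartialHomeomorph_target he hn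
  have hsymm : H.symm (Φ p) = p := H.left_inv hps
  have htarget : ∀ᶠ y in 𝓝 (Φ p), y ∈ H.target := H.open_target.mem_nhds hpt
  have htend : Tendsto H.symm (𝓝 (Φ p)) (𝓝 p) := by
    have := H.continuousAt_symm hpt
    rwa [ContinuousAt, hsymm] at this
  have hright : ∀ᶠ y in 𝓝 (Φ p), Φ (H.symm y) = y := htarget.mono fun y hy => H.right_inv hy
  have hleft : ∀ᶠ x in 𝓝 p, H.symm (Φ x) = x := by
    filter_upwards [H.open_source.mem_nhds hps] with x hx
    exact H.left_inv hx
  have hinv : ∀ᶠ x in 𝓝 p, fderiv ℝ Φ x ∈ Set.range ((↑) : (E ≃L[ℝ] F) → E →L[ℝ] F) := by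
    -- Invertibility of the derivative is an open condition, which gives smoothness of the inverse
    -- on a whole neighbourhood and not only at the base point.
    have hc : ContinuousAt (fderiv ℝ Φ) p :=
      (hp.fderiv_right (m := ∞) (by simp)).continuousAt
    refine hc ?_
    rw [he.fderiv]
    exact e.nhds
  refine ⟨H.symm, ⟨hsymm, ?_, Φ, hs, hright, hleft⟩, hright⟩
  filter_upwards [htarget, htend.eventually hs, htend.eventually hinv] with y hy hy1 hy2
  obtain ⟨e', he'⟩ := hy2
  refine H.contDiffAt_symm hy (f₀' := e') ?_ hy1
  rw [he']
  exact (hy1.differentiableAt hn).hasFDerivAt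

/-- The rotation whose rows are proportional to `X = (1, A, B)`, `Y = (B - kA, k, -1)` and
`X × Y`. -/
theorem adaptedRotation_mem {A B k a b : ℝ} (ha : a ^ 2 * (1 + A ^ 2 + B ^ 2) = 1)
    (hb : b ^ 2 * (1 + k ^ 2 + (B - k * A) ^ 2) = 1) :
    !![a, a * A, a * B; b * (B - k * A), b * k, -b;
      a * b * (-A - B * k), a * b * (1 + B * (B - k * A)), a * b * (k - A * (B - k * A))]
      ∈ Matrix.specialOrthogonalGroup (Fin 3) ℝ := by
  have hab : a ^ 2 * b ^ 2 * ((1 + A ^ 2 + B ^ 2) * (1 + k ^ 2 + (B - k * A) ^ 2)) = 1 := by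
    linear_combination ha * (b ^ 2 * (1 + k ^ 2 + (B - k * A) ^ 2)) + hb
  rw [Matrix.mem_specialOrthogonalGroup_iff, Matrix.mem_orthogonalGroup_iff]
  constructor
  · ext i j
    fin_cases i <;> fin_cases j <;>
      simp [Matrix.mul_apply, Fin.sum_univ_three]
    · linear_combination ha
    · ring
    · ring
    · ring
    · linear_combination hb
    · ring
    · ring
    · ring
    · linear_combination hab
  · rw [Matrix.det_fin_three]
    simp
    linear_combination hab

/-- With rows along X, Y and X × Y, the rotation removes the linear terms of components 1 and 2 and
the z₂² term of component 1. What is left of component 1 factors as z₁(F₁ z₁ + H z₂) modulo O(3),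
with H ≠ 0 because h ≠ 0, so its two factors, rescaled, can serve as coordinates x and y. -/
theorem HasUmbrellaJet.exists_bruceWest {f : ℝ × ℝ → Fin 3 → ℝ} {p : ℝ × ℝ}
    {A B A' B' k h : ℝ} (hf : HasUmbrellaJet f p A B A' B' k h 0) (hs : IsSmoothGerm f p)
    (hh : h ≠ 0) : ∃ b20 b11 b02 : ℝ, IsBruceWest f p b20 b11 b02 := by
  have hN : 0 < 1 + A ^ 2 + B ^ 2 := by positivity
  have hM : 0 < 1 + k ^ 2 + (B - k * A) ^ 2 := by positivity
  obtain ⟨a, ha0, ha⟩ : ∃ a : ℝ, 0 < a ∧ a ^ 2 * (1 + A ^ 2 + B ^ 2) = 1 :=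
    ⟨(√(1 + A ^ 2 + B ^ 2))⁻¹, by positivity, by
      rw [inv_pow, Real.sq_sqrt hN.le, inv_mul_cancel₀ hN.ne']⟩
  obtain ⟨b, hb0, hb⟩ : ∃ b : ℝ, 0 < b ∧ b ^ 2 * (1 + k ^ 2 + (B - k * A) ^ 2) = 1 :=
    ⟨(√(1 + k ^ 2 + (B - k * A) ^ 2))⁻¹, by positivity, by
      rw [inv_pow, Real.sq_sqrt hM.le, inv_mul_cancel₀ hM.ne']⟩
  have hT := adaptedRotation_mem ha hb
  obtain ⟨T, hTdef⟩ : ∃ T : Matrix (Fin 3) (Fin 3) ℝ, T = !![a, a * A, a * B;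
    b * (B - k * A), b * k, -b; a * b * (-A - B * k), a * b * (1 + B * (B - k * A)),
      a * b * (k - A * (B - k * A))] := ⟨_, rfl⟩
  rw [← hTdef] at hT
  have hj0 := hf.mulVec_apply T 0
  have hj1 := hf.mulVec_apply T 1
  have hj2 := hf.mulVec_apply T 2
  have ht0 : T 0 0 + T 0 1 * A + T 0 2 * B = a⁻¹ := by
    have : a * a⁻¹ = 1 := mul_inv_cancel₀ ha0.ne'
    have hTX : T 0 0 + T 0 1 * A + T 0 2 * B = a + a * A * A + a * B * B := by simp [hTdef]
    rw [hTX]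
    refine mul_left_cancel₀ ha0.ne' ?_
    linear_combination ha - this
  have ht1 : T 1 0 + T 1 1 * A + T 1 2 * B = 0 := by simp [hTdef]; ring
  have ht2 : T 2 0 + T 2 1 * A + T 2 2 * B = 0 := by simp [hTdef]; ring
  have hg1 : T 1 1 + T 1 2 * k = 0 := by simp [hTdef]
  have hg2 : 0 < T 2 1 + T 2 2 * k := by
    have : T 2 1 + T 2 2 * k = a * b * (1 + k ^ 2 + (B - k * A) ^ 2) := by
      simp [hTdef]; ring
    rw [this]
    positivity
  have hH : T 1 2 * h ≠ 0 := by simp [hTdef, hb0.ne', hh]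
  rw [ht0] at hj0
  rw [ht1, hg1] at hj1
  rw [ht2] at hj2
  generalize T 1 2 * h = H at *
  generalize T 2 1 + T 2 2 * k = G at *
  generalize (T 1 1 * A' + T 1 2 * B') / 2 = F₁ at *
  generalize (T 2 1 * A' + T 2 2 * B') / 2 = F₂ at *
  generalize T 2 2 * h = H₂ at *
  clear ha hb ht0 ht1 ht2 hg1 hTdef hN hM hh
  have haa : a * a⁻¹ = 1 := mul_inv_cancel₀ ha0.ne'
  -- the inverse coordinate change and its derivative
  let fst := ContinuousLinearMap.fst ℝ ℝ ℝ
  let snd := ContinuousLinearMap.snd ℝ ℝ ℝ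
  let e : (ℝ × ℝ) ≃L[ℝ] ℝ × ℝ := ContinuousLinearEquiv.equivOfInverse
    ((a⁻¹ • fst).prod ((a * F₁) • fst + (a * H) • snd))
    ((a • fst).prod ((-(F₁ * a) / H) • fst + (a⁻¹ / H) • snd))
    (fun z => by ext <;> simp [fst, snd] <;> field_simp <;> ring)
    (fun z => by ext <;> simp [fst, snd] <;> field_simp <;> ring)
  -- The first coordinate is the full component 0, so that it becomes exactly x. As x = a⁻¹ z₁ +
  -- O(2), the factor a in the second coordinate makes the product equal to xy modulo O(3).
  let Φ : ℝ × ℝ → ℝ × ℝ := fun w =>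
    ((T *ᵥ (f w - f p)) 0, a * F₁ * (w.1 - p.1) + a * H * (w.2 - p.2))
  have hΦp : Φ p = 0 := by simp [Φ]
  have hΦs : IsSmoothGerm Φ p := by
    filter_upwards [hs] with w hw
    refine ContDiffAt.prodMk ?_ (by fun_prop)
    have hc : ∀ i, ContDiffAt ℝ ∞ (fun w => f w i) w := contDiffAt_pi.1 hw
    simp only [mulVec, dotProduct, Fin.sum_univ_three, Pi.sub_apply]
    have := hc 0
    have := hc 1
    have := hc 2
    fun_prop
  have hΦ1 : (fun z => (Φ (p + z)).1 - a⁻¹ * z.1) =O[𝓝 0] fun z => ‖z‖ ^ 2 := by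
    refine ((hj0.trans isBigO_norm_cube_sq).add
      (isBigO_quadratic ((T 0 1 * A' + T 0 2 * B') / 2) (T 0 2 * h)
        (T 0 1 + T 0 2 * k))).congr_left fun z => ?_
    simp only [Φ]
    ring
  have hΦd : HasFDerivAt Φ (e : (ℝ × ℝ) →L[ℝ] ℝ × ℝ) p := by
    refine hasFDerivAt_of_isBigO_sq ?_
    rw [hΦp]
    refine IsBigO.congr_left (f₁ := fun z => ((Φ (p + z)).1 - a⁻¹ * z.1, (0 : ℝ))) ?_ fun z => ?_
    · exact hΦ1.prod_left (isBigO_zero _ _)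
    · simp [e, fst, snd, Φ]
  obtain ⟨φ, hφ, hΦφ⟩ := hΦs.exists_inverse hΦd
  rw [hΦp] at hφ hΦφ
  have hφ' := hφ
  obtain ⟨hφ0, hφs, -⟩ := hφ'
  have hφc : ContDiffAt ℝ ∞ φ 0 := hφs.self_of_nhds
  obtain ⟨z, hz⟩ : ∃ z : ℝ × ℝ → ℝ × ℝ, z = fun x => φ x - p := ⟨_, rfl⟩
  have hφz : ∀ x, φ x = p + z x := fun x => by simp [hz]
  have hz0 : Tendsto z (𝓝 0) (𝓝 0) := by
    have : Tendsto z (𝓝 0) (𝓝 (φ 0 - p)) := by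
      rw [hz]
      exact hφc.continuousAt.sub continuousAt_const
    simpa [hφ0] using this
  have hzO : z =O[𝓝 0] fun x => ‖x‖ := by
    have := (hφc.differentiableAt (by simp)).isBigO_sub
    rw [hz]
    simpa [hφ0] using this.norm_right
  have hO1 : (fun x => (z x).1) =O[𝓝 0] fun x => ‖x‖ :=
    (isBigO_fst_norm.comp_tendsto hz0).trans hzO.norm_left
  have hO2 : (fun x => (z x).2) =O[𝓝 0] fun x => ‖x‖ :=
    (isBigO_snd_norm.comp_tendsto hz0).trans hzO.norm_left
  have hx1 : ∀ᶠ x in 𝓝 0, (Φ (p + z x)).1 = x.1 := by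
    filter_upwards [hΦφ] with x hx
    rw [← hφz, hx]
  have hx2 : ∀ᶠ x in 𝓝 0, F₁ * (z x).1 + H * (z x).2 = a⁻¹ * x.2 := by
    filter_upwards [hΦφ] with x hx
    have h2 : (Φ (p + z x)).2 = x.2 := by rw [← hφz, hx]
    simp only [Φ, Prod.fst_add, Prod.snd_add, add_sub_cancel_left] at h2
    rw [← h2]
    linear_combination -(F₁ * (z x).1 + H * (z x).2) * haa
  have hz1 : (fun x => (z x).1 - a * x.1) =O[𝓝 0] fun x => ‖x‖ ^ 2 := by
    have := ((hΦ1.comp_tendsto hz0).trans (hzO.norm_left.pow 2)).const_mul_left (-a)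
    refine this.congr' ?_ EventuallyEq.rfl
    filter_upwards [hx1] with x hx
    simp only [Function.comp_apply, hx]
    linear_combination (z x).1 * haa
  have hz2 : (fun x => (z x).2 - (-(F₁ * a) / H * x.1 + a⁻¹ / H * x.2))
      =O[𝓝 0] fun x => ‖x‖ ^ 2 := by
    refine (hz1.const_mul_left (-(F₁ / H))).congr' ?_ EventuallyEq.rfl
    filter_upwards [hx2] with x hx
    have : (z x).2 = (a⁻¹ * x.2 - F₁ * (z x).1) / H := by
      rw [← hx]; field_simp; ring
    rw [this]
    field_simp
    ring
  have hl1 : (fun x : ℝ × ℝ => a * x.1) =O[𝓝 0] fun x => ‖x‖ :=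
    isBigO_fst_norm.const_mul_left _
  have hl2 : (fun x : ℝ × ℝ => -(F₁ * a) / H * x.1 + a⁻¹ / H * x.2) =O[𝓝 0] fun x => ‖x‖ :=
    (isBigO_fst_norm.const_mul_left _).add (isBigO_snd_norm.const_mul_left _)
  have hcomp : ∀ {g : ℝ × ℝ → ℝ}, g =O[𝓝 0] (fun z => ‖z‖ ^ 3) →
      (fun x => g (z x)) =O[𝓝 0] fun x => ‖x‖ ^ 3 := fun hg =>
    (hg.comp_tendsto hz0).trans (hzO.norm_left.pow 3)
  refine ⟨2 * (F₂ * a ^ 2 + H₂ * (a * (-(F₁ * a) / H)) + G * (-(F₁ * a) / H) ^ 2),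
    H₂ * (a * (a⁻¹ / H)) + 2 * G * ((a⁻¹ / H) * (-(F₁ * a) / H)), 2 * (G * (a⁻¹ / H) ^ 2),
    by positivity, φ, T, hφ, hT, ?_, ?_, ?_⟩
  · filter_upwards [hx1] with x hx
    rw [hφz, ← hx]
  · have hm := isBigO_mul_sub_mul hz1 (g := fun x => a⁻¹ * x.2) (g₀ := fun x => a⁻¹ * x.2)
      (by simpa using isBigO_zero _ _) hO1 (isBigO_snd_norm.const_mul_left _)
    refine ((hcomp hj1).add hm).congr' ?_ EventuallyEq.rfl
    filter_upwards [hx2] with x hx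
    rw [hφz]
    linear_combination -(z x).1 * hx - x.1 * x.2 * haa
  · have hm := (((isBigO_mul_sub_mul hz1 hz1 hO1 hl1).const_mul_left F₂).add
      ((isBigO_mul_sub_mul hz1 hz2 hO1 hl2).const_mul_left H₂)).add
      ((isBigO_mul_sub_mul hz2 hz2 hO2 hl2).const_mul_left G)
    refine ((hcomp hj2).add hm).congr_left fun x => ?_
    rw [hφz]
    ring

/-! ### Derivatives and Taylor expansions in the first variable. -/

/-- The partial derivative with respect to the first variable. -/
noncomputable def partialFst (F : ℝ × ℝ → ℝ) (x : ℝ × ℝ) : ℝ := fderiv ℝ F x (1, 0)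

theorem ContDiffAt.partialFst {F : ℝ × ℝ → ℝ} {x : ℝ × ℝ} (hF : ContDiffAt ℝ ∞ F x) :
    ContDiffAt ℝ ∞ (partialFst F) x :=
  (hF.fderiv_right (m := ∞) (by simp)).clm_apply contDiffAt_const

theorem IsSmoothGerm.partialFst {F : ℝ × ℝ → ℝ} {x : ℝ × ℝ} (hF : IsSmoothGerm F x) :
    IsSmoothGerm (partialFst F) x :=
  hF.mono fun _ hy => hy.partialFst

theorem ContDiffAt.hasDerivAt_partialFst {F : ℝ × ℝ → ℝ} {u s : ℝ}
    (hF : ContDiffAt ℝ ∞ F (u, s)) :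
    HasDerivAt (fun u => F (u, s)) (_root_.partialFst F (u, s)) u :=
  (hF.differentiableAt (by simp)).hasFDerivAt.comp_hasDerivAt u
    ((hasDerivAt_id u).prodMk (hasDerivAt_const u s))

theorem IsSmoothGerm.partialFst_slice {F : ℝ × ℝ → ℝ} (hF : IsSmoothGerm F 0) :
    (fun u => _root_.partialFst F (u, 0)) =ᶠ[𝓝 0] deriv fun u => F (u, 0) := by
  have ht : Tendsto (fun u : ℝ => (u, (0 : ℝ))) (𝓝 0) (𝓝 0) :=
    Continuous.tendsto' (by fun_prop) _ _ rfl
  filter_upwards [ht.eventually hF] with u hu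
  exact hu.hasDerivAt_partialFst.deriv.symm

theorem IsSmoothGerm.partialFst_two_slice {F : ℝ × ℝ → ℝ} (hF : IsSmoothGerm F 0) :
    (fun u => _root_.partialFst (_root_.partialFst F) (u, 0))
      =ᶠ[𝓝 0] deriv (deriv fun u => F (u, 0)) :=
  hF.partialFst.partialFst_slice.trans hF.partialFst_slice.deriv

/-- The part of the components of the normal form that is independent of `v`. -/
def axisPart (f : ℝ → ℝ) (g : ℝ × ℝ → ℝ) (x : ℝ × ℝ) : ℝ :=
  x.1 ^ 2 * f x.1 + x.1 * x.2 * g x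

theorem ContDiffAt.axisPart {f : ℝ → ℝ} {g : ℝ × ℝ → ℝ} {x : ℝ × ℝ}
    (hf : ContDiffAt ℝ ∞ f x.1) (hg : ContDiffAt ℝ ∞ g x) :
    ContDiffAt ℝ ∞ (axisPart f g) x := by
  have h1 : ContDiffAt ℝ ∞ (fun y : ℝ × ℝ => f y.1) x := hf.comp x contDiffAt_fst
  unfold _root_.axisPart
  fun_prop

theorem IsSmoothGerm.axisPart {f : ℝ → ℝ} {g : ℝ × ℝ → ℝ}
    (hf : IsSmoothGerm f 0) (hg : IsSmoothGerm g 0) : IsSmoothGerm (axisPart f g) 0 := by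
  have ht : Tendsto (fun x : ℝ × ℝ => x.1) (𝓝 0) (𝓝 0) :=
    Continuous.tendsto' (by fun_prop) _ _ rfl
  filter_upwards [ht.eventually hf, hg] with x h1 h2
  exact h1.axisPart h2

/-- Second order expansion in the first variable. -/
theorem IsSmoothGerm.isBigO_slice_taylor_two {F : ℝ × ℝ → ℝ} {x : ℝ × ℝ}
    (hF : IsSmoothGerm F x) :
    (fun z : ℝ × ℝ => F (x.1 + z.1, x.2) - F x - _root_.partialFst F x * z.1
      - _root_.partialFst (_root_.partialFst F) x / 2 * z.1 ^ 2) =O[𝓝 0] fun z => ‖z‖ ^ 3 := by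
  have ht : Tendsto (fun u : ℝ => (u, x.2)) (𝓝 x.1) (𝓝 x) :=
    Continuous.tendsto' (by fun_prop) _ _ rfl
  have hF0 : ContDiffAt ℝ ∞ F x := hF.self_of_nhds
  have h1 := isBigO_taylor_two (g := fun u => F (u, x.2))
    (g₁ := fun u => _root_.partialFst F (u, x.2))
    (g₂ := fun u => _root_.partialFst (_root_.partialFst F) (u, x.2)) (x := x.1)
    ((ht.eventually hF).mono fun u hu => hu.hasDerivAt_partialFst)
    ((ht.eventually hF).mono fun u hu => hu.partialFst.hasDerivAt_partialFst)
    (hF0.partialFst.partialFst.hasDerivAt_partialFst).differentiableAt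
  have hfst : Tendsto (fun z : ℝ × ℝ => z.1) (𝓝 0) (𝓝 0) :=
    Continuous.tendsto' (by fun_prop) _ _ rfl
  exact (h1.comp_tendsto hfst).trans (isBigO_fst_norm.norm_left.pow 3)

theorem ContDiffAt.isBigO_slice_taylor_one {F : ℝ × ℝ → ℝ} {x : ℝ × ℝ}
    (hF : ContDiffAt ℝ ∞ F x) :
    (fun z : ℝ × ℝ => F (x.1 + z.1, x.2) - F x - _root_.partialFst F x * z.1)
      =O[𝓝 0] fun z => ‖z‖ ^ 2 := by
  have ht : Tendsto (fun z : ℝ × ℝ => (z.1, (0 : ℝ))) (𝓝 0) (𝓝 0) :=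
    Continuous.tendsto' (by fun_prop) _ _ rfl
  have hO : (fun z : ℝ × ℝ => (z.1, (0 : ℝ))) =O[𝓝 0] fun z => ‖z‖ :=
    isBigO_fst_norm.prod_left (isBigO_zero _ _)
  refine ((hF.isBigO_sub_fderiv.comp_tendsto ht).trans (hO.norm_left.pow 2)).congr_left
    fun z => ?_
  have h1 : fderiv ℝ F x (z.1, 0) = z.1 * fderiv ℝ F x (1, 0) := by
    rw [← smul_eq_mul, ← map_smul]
    simp
  have h2 : x + (z.1, 0) = (x.1 + z.1, x.2) := by ext <;> simp
  simp only [Function.comp_apply, _root_.partialFst, h1, h2]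
  ring

/-! ### The jet of the normal form along the u-axis. -/

section NormalForm

variable {f21 f31 : ℝ → ℝ} {f24 f33 f34 : ℝ × ℝ → ℝ} {f32 : ℝ × ℝ × ℝ → ℝ}

/-- The point `x` stands for the pair (u, s). Modulo O(3), the factor v² leaves only the value of
f32 at (u, 0, s), and the factor v only the first order part of f33 in u. -/
theorem hasUmbrellaJet_normalForm {x : ℝ × ℝ} (h2 : IsSmoothGerm (axisPart f21 f24) x)
    (h3 : IsSmoothGerm (axisPart f31 f34) x) (h33 : ContDiffAt ℝ ∞ f33 x)
    (h32 : ContDiffAt ℝ ∞ f32 (x.1, 0, x.2)) :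
    HasUmbrellaJet (normalForm f21 f31 f24 f33 f34 f32 x.2) (x.1, 0)
      (partialFst (axisPart f21 f24) x) (partialFst (axisPart f31 f34) x)
      (partialFst (partialFst (axisPart f21 f24)) x)
      (partialFst (partialFst (axisPart f31 f34)) x)
      (f32 (x.1, 0, x.2)) (partialFst f33 x) (f33 x) := by
  refine ⟨fun z => by simp [normalForm], ?_, ?_⟩
  · refine h2.isBigO_slice_taylor_two.congr_left fun z => ?_
    simp [normalForm, axisPart]
    ring
  · have hk : (fun z : ℝ × ℝ => f32 (x.1 + z.1, z.2, x.2) - f32 (x.1, 0, x.2))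
        =O[𝓝 0] fun z => ‖z‖ := by
      have hd : DifferentiableAt ℝ (fun z : ℝ × ℝ => f32 (x.1 + z.1, z.2, x.2)) 0 := by
        refine DifferentiableAt.comp (g := f32)
          (f := fun z : ℝ × ℝ => (x.1 + z.1, z.2, x.2)) 0 ?_ (by fun_prop)
        simpa using h32.differentiableAt (by simp)
      simpa using hd.isBigO_sub.norm_right
    have hk' := hk.mul (isBigO_snd_norm.pow 2)
    have hw := h33.isBigO_slice_taylor_one.mul isBigO_snd_norm
    refine ((h3.isBigO_slice_taylor_two.add (hk'.congr_right fun z => ?_)).add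
      (hw.congr_right fun z => ?_)).congr_left fun z => ?_
    · ring
    · ring
    · simp [normalForm, axisPart]
      ring

theorem isSmoothGerm_normalForm {s : ℝ} {p : ℝ × ℝ} (h21 : IsSmoothGerm f21 p.1)
    (h31 : IsSmoothGerm f31 p.1) (h24 : IsSmoothGerm f24 (p.1, s))
    (h33 : IsSmoothGerm f33 (p.1, s)) (h34 : IsSmoothGerm f34 (p.1, s))
    (h32 : IsSmoothGerm f32 (p.1, p.2, s)) :
    IsSmoothGerm (normalForm f21 f31 f24 f33 f34 f32 s) p := by
  have t1 : Tendsto (fun w : ℝ × ℝ => w.1) (𝓝 p) (𝓝 p.1) := continuousAt_fst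
  have t2 : Tendsto (fun w : ℝ × ℝ => (w.1, s)) (𝓝 p) (𝓝 (p.1, s)) :=
    Continuous.tendsto' (by fun_prop) _ _ rfl
  have t3 : Tendsto (fun w : ℝ × ℝ => (w.1, w.2, s)) (𝓝 p) (𝓝 (p.1, p.2, s)) :=
    Continuous.tendsto' (by fun_prop) _ _ rfl
  filter_upwards [t1.eventually h21, t1.eventually h31, t2.eventually h24, t2.eventually h33,
    t2.eventually h34, t3.eventually h32] with w w21 w31 w24 w33 w34 w32
  have e21 : ContDiffAt ℝ ∞ (fun y : ℝ × ℝ => f21 y.1) w := w21.comp w contDiffAt_fst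
  have e31 : ContDiffAt ℝ ∞ (fun y : ℝ × ℝ => f31 y.1) w := w31.comp w contDiffAt_fst
  have e24 : ContDiffAt ℝ ∞ (fun y : ℝ × ℝ => f24 (y.1, s)) w :=
    w24.comp (f := fun y : ℝ × ℝ => (y.1, s)) w (by fun_prop)
  have e33 : ContDiffAt ℝ ∞ (fun y : ℝ × ℝ => f33 (y.1, s)) w :=
    w33.comp (f := fun y : ℝ × ℝ => (y.1, s)) w (by fun_prop)
  have e34 : ContDiffAt ℝ ∞ (fun y : ℝ × ℝ => f34 (y.1, s)) w :=
    w34.comp (f := fun y : ℝ × ℝ => (y.1, s)) w (by fun_prop)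
  have e32 : ContDiffAt ℝ ∞ (fun y : ℝ × ℝ => f32 (y.1, y.2, s)) w :=
    w32.comp (f := fun y : ℝ × ℝ => (y.1, y.2, s)) w (by fun_prop)
  rw [contDiffAt_pi]
  intro i
  fin_cases i
  · simp [normalForm]; fun_prop
  · simp [normalForm]; fun_prop
  · simp [normalForm]; fun_prop

/-- Near the origin the normal form is smooth and has the jet given by its coefficients. -/
theorem IsS1NormalForm.eventually_jet (hf : IsS1NormalForm f21 f31 f24 f33 f34 f32) :
    ∀ᶠ x in 𝓝 (0 : ℝ × ℝ), IsSmoothGerm (normalForm f21 f31 f24 f33 f34 f32 x.2) (x.1, 0) ∧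
      HasUmbrellaJet (normalForm f21 f31 f24 f33 f34 f32 x.2) (x.1, 0)
        (partialFst (axisPart f21 f24) x) (partialFst (axisPart f31 f34) x)
        (partialFst (partialFst (axisPart f21 f24)) x)
        (partialFst (partialFst (axisPart f31 f34)) x)
        (f32 (x.1, 0, x.2)) (partialFst f33 x) (f33 x) := by
  have t1 : Tendsto (fun x : ℝ × ℝ => x.1) (𝓝 0) (𝓝 0) :=
    Continuous.tendsto' (by fun_prop) _ _ rfl
  have t3 : Tendsto (fun x : ℝ × ℝ => (x.1, (0 : ℝ), x.2)) (𝓝 0) (𝓝 0) :=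
    Continuous.tendsto' (by fun_prop) _ _ rfl
  filter_upwards [t1.eventually (eventually_eventually_nhds.2 hf.smooth21),
    t1.eventually (eventually_eventually_nhds.2 hf.smooth31),
    eventually_eventually_nhds.2 hf.smooth24, eventually_eventually_nhds.2 hf.smooth33,
    eventually_eventually_nhds.2 hf.smooth34,
    t3.eventually (eventually_eventually_nhds.2 hf.smooth32),
    eventually_eventually_nhds.2 (hf.smooth21.axisPart hf.smooth24),
    eventually_eventually_nhds.2 (hf.smooth31.axisPart hf.smooth34)]
    with x h21 h31 h24 h33 h34 h32 h2 h3
  exact ⟨isSmoothGerm_normalForm h21 h31 h24 h33 h34 h32,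
    hasUmbrellaJet_normalForm h2 h3 h33.self_of_nhds h32.self_of_nhds⟩

end NormalForm

/-! ### Differentials and singular points. -/

/-- The derivative of a map with an umbrella jet. -/
theorem HasUmbrellaJet.hasFDerivAt {f : ℝ × ℝ → Fin 3 → ℝ} {p : ℝ × ℝ}
    {A B A' B' k h w : ℝ} (hf : HasUmbrellaJet f p A B A' B' k h w) :
    HasFDerivAt f (ContinuousLinearMap.pi ![ContinuousLinearMap.fst ℝ ℝ ℝ,
      A • ContinuousLinearMap.fst ℝ ℝ ℝ,
      B • ContinuousLinearMap.fst ℝ ℝ ℝ + w • ContinuousLinearMap.snd ℝ ℝ ℝ]) p := by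
  rw [hasFDerivAt_pi']
  intro i
  refine hasFDerivAt_of_isBigO_sq ?_
  fin_cases i
  · refine (isBigO_zero _ _).congr_left fun z => ?_
    simp [hf.fst z]
  · refine ((hf.snd.trans isBigO_norm_cube_sq).add
      (isBigO_quadratic (A' / 2) 0 1)).congr_left fun z => ?_
    simp
    ring
  · refine ((hf.trd.trans isBigO_norm_cube_sq).add
      (isBigO_quadratic (B' / 2) h k)).congr_left fun z => ?_
    simp
    ring

/-- The differential is z ↦ (z₁, A z₁, B z₁ + w z₂), which is injective once w ≠ 0. -/
theorem HasUmbrellaJet.eq_zero_of_mem_singularSet {f : ℝ × ℝ → Fin 3 → ℝ} {p : ℝ × ℝ}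
    {A B A' B' k h w : ℝ} (hf : HasUmbrellaJet f p A B A' B' k h w) (hp : p ∈ singularSet f) :
    w = 0 := by
  by_contra hw
  refine hp ?_
  rw [hf.hasFDerivAt.fderiv, injective_iff_map_eq_zero]
  intro z hz
  have h0 : z.1 = 0 := by simpa using congrFun hz 0
  have h2 : B * z.1 + w * z.2 = 0 := by simpa using congrFun hz 2
  rw [h0, mul_zero, zero_add] at h2
  exact Prod.ext h0 ((mul_eq_zero.1 h2).resolve_left hw)

/-! ### An S₁ singularity has c₂(0) ≠ 0. -/

section Nondegeneracy

theorem ContDiffAt.eventually_norm_fderiv_le {E F : Type*} [NormedAddCommGroup E]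
    [NormedSpace ℝ E] [NormedAddCommGroup F] [NormedSpace ℝ F] {g : E → F} {x : E}
    (hg : ContDiffAt ℝ ∞ g x) : ∃ C, 0 < C ∧ ∀ᶠ y in 𝓝 x, ‖fderiv ℝ g y‖ ≤ C := by
  have hc : ContinuousAt (fderiv ℝ g) x :=
    (hg.fderiv_right (m := ∞) (by simp)).continuousAt
  refine ⟨‖fderiv ℝ g x‖ + 1, by positivity, ?_⟩
  exact (hc.norm.eventually (gt_mem_nhds (lt_add_one _))).mono fun y hy => le_of_lt hy

/-- A quadratic lower bound on the differential near the origin is invariant under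
`𝒜`-equivalence. -/
theorem AEquivalent.fderiv_lower_bound {f₁ f₂ : ℝ × ℝ → Fin 3 → ℝ} (h : AEquivalent f₁ f₂)
    (h₁ : IsSmoothGerm f₁ 0) (h₁0 : f₁ 0 = 0) (h₂ : Differentiable ℝ f₂) {K : ℝ} (hK0 : 0 ≤ K)
    (hK : ∀ᶠ x in 𝓝 (0 : ℝ × ℝ), ∀ w, ‖x‖ ^ 2 * ‖w‖ ≤ K * ‖fderiv ℝ f₂ x w‖) :
    ∃ K', ∀ᶠ x in 𝓝 (0 : ℝ × ℝ), ∀ w, ‖x‖ ^ 2 * ‖w‖ ≤ K' * ‖fderiv ℝ f₁ x w‖ := by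
  obtain ⟨φ, ψ, ⟨hφ0, hφs, χ, hχs, hχφ, -⟩, ⟨-, hψs, -⟩, hconj⟩ := h
  have hn : (∞ : WithTop ℕ∞) ≠ 0 := by simp
  have tφ : Tendsto φ (𝓝 0) (𝓝 0) := by
    have : ContinuousAt φ 0 := (hφs.self_of_nhds).continuousAt
    rwa [ContinuousAt, hφ0] at this
  have tf : Tendsto f₁ (𝓝 0) (𝓝 0) := by
    have : ContinuousAt f₁ 0 := (h₁.self_of_nhds).continuousAt
    rwa [ContinuousAt, h₁0] at this
  have hχ0 : χ 0 = 0 := by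
    have := hχφ.self_of_nhds
    rwa [hφ0] at this
  have hχc : ContDiffAt ℝ ∞ χ 0 := hχs.self_of_nhds
  have hψc : ContDiffAt ℝ ∞ ψ 0 := hψs.self_of_nhds
  obtain ⟨Cψ, hCψ, bψ⟩ := hψc.eventually_norm_fderiv_le
  obtain ⟨Cχ, hCχ, bχ⟩ := hχc.eventually_norm_fderiv_le
  obtain ⟨C, hC, bC⟩ := (hχc.differentiableAt hn).isBigO_sub.exists_pos
  refine ⟨C ^ 2 * Cχ * (K * Cψ), ?_⟩
  filter_upwards [tφ.eventually hK, hφs, h₁, tφ.eventually hχs, tf.eventually hψs,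
    eventually_eventually_nhds.2 hχφ, eventually_eventually_nhds.2 hconj, tf.eventually bψ,
    tφ.eventually bχ, tφ.eventually bC.bound] with x xK xφ x1 xχ xψ xχφ xconj xbψ xbχ xbC w
  have dφ := (xφ.differentiableAt hn).hasFDerivAt
  have d1 := (x1.differentiableAt hn).hasFDerivAt
  have dχ := (xχ.differentiableAt hn).hasFDerivAt
  have dψ := (xψ.differentiableAt hn).hasFDerivAt
  have d2 := (h₂ (φ x)).hasFDerivAt
  have e1 : fderiv ℝ f₂ (φ x) (fderiv ℝ φ x w) = fderiv ℝ ψ (f₁ x) (fderiv ℝ f₁ x w) := by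
    have h1 : HasFDerivAt (fun y => f₂ (φ y)) _ x := d2.comp x dφ
    have h2 : HasFDerivAt (fun y => ψ (f₁ y)) _ x := dψ.comp x d1
    have h3 := (h2.congr_of_eventuallyEq xconj).unique h1
    exact (DFunLike.congr_fun h3 w).symm
  -- Differentiating χ ∘ φ = id bounds dφ from below.
  have e2 : fderiv ℝ χ (φ x) (fderiv ℝ φ x w) = w := by
    have h1 : HasFDerivAt (fun y => χ (φ y)) _ x := dχ.comp x dφ
    have h2 := ((hasFDerivAt_id x).congr_of_eventuallyEq xχφ).unique h1
    exact (DFunLike.congr_fun h2 w).symm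
  have hw : ‖w‖ ≤ Cχ * ‖fderiv ℝ φ x w‖ := by
    conv_lhs => rw [← e2]
    exact (ContinuousLinearMap.le_opNorm _ _).trans (by gcongr)
  have hx : ‖x‖ ≤ C * ‖φ x‖ := by
    have := xχφ.self_of_nhds
    rw [this, hχ0] at xbC
    simpa using xbC
  have hψ : ‖fderiv ℝ ψ (f₁ x) (fderiv ℝ f₁ x w)‖ ≤ Cψ * ‖fderiv ℝ f₁ x w‖ :=
    (ContinuousLinearMap.le_opNorm _ _).trans (by gcongr)
  calc ‖x‖ ^ 2 * ‖w‖ ≤ (C * ‖φ x‖) ^ 2 * (Cχ * ‖fderiv ℝ φ x w‖) := by gcongr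
    _ = C ^ 2 * Cχ * (‖φ x‖ ^ 2 * ‖fderiv ℝ φ x w‖) := by ring
    _ ≤ C ^ 2 * Cχ * (K * ‖fderiv ℝ f₂ (φ x) (fderiv ℝ φ x w)‖) := 
      mul_le_mul_of_nonneg_left (xK _) (by positivity)
    _ ≤ C ^ 2 * Cχ * (K * (Cψ * ‖fderiv ℝ f₁ x w‖)) := by rw [e1]; gcongr
    _ = _ := by ring

/-- The map germ `(u, v) ↦ (u, v², v (u² + ε v²))`. -/
def s1Model (ε : ℝ) (x : ℝ × ℝ) : Fin 3 → ℝ := ![x.1, x.2 ^ 2, x.2 * (x.1 ^ 2 + ε * x.2 ^ 2)]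

theorem differentiable_s1Model (ε : ℝ) : Differentiable ℝ (s1Model ε) := by
  rw [differentiable_pi]
  intro i
  fin_cases i <;> simp [s1Model] <;> fun_prop

theorem fderiv_s1Model (ε : ℝ) (x w : ℝ × ℝ) : fderiv ℝ (s1Model ε) x w =
    ![w.1, 2 * x.2 * w.2, 2 * x.1 * x.2 * w.1 + (x.1 ^ 2 + 3 * ε * x.2 ^ 2) * w.2] := by
  have h1 : HasDerivAt (fun r : ℝ => x + r • w) w 0 := by
    simpa using ((hasDerivAt_id (0 : ℝ)).smul_const w).const_add x
  have h2 : HasDerivAt (fun r : ℝ => s1Model ε (x + r • w)) (fderiv ℝ (s1Model ε) x w) 0 := by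
    have h3 := (differentiable_s1Model ε (x + (0 : ℝ) • w)).hasFDerivAt.comp_hasDerivAt 0 h1
    rwa [zero_smul, add_zero] at h3
  refine h2.unique ?_
  have k1 : HasDerivAt (fun r : ℝ => x.1 + r * w.1) w.1 0 := by
    simpa using ((hasDerivAt_id (0 : ℝ)).mul_const w.1).const_add x.1
  have k2 : HasDerivAt (fun r : ℝ => x.2 + r * w.2) w.2 0 := by
    simpa using ((hasDerivAt_id (0 : ℝ)).mul_const w.2).const_add x.2
  rw [hasDerivAt_pi]
  intro i
  fin_cases i
  · exact k1
  · exact (k2.pow 2).congr_deriv (by simp)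
  · refine (k2.mul ((k1.pow 2).add ((k2.pow 2).const_mul ε))).congr_deriv ?_
    simp
    ring

/-- The first two entries of the differential control w₁ and x₂ w₂. Subtracting their contributions
from the third entry leaves x₁² w₂, at a cost of 1 + 2 + 3/2 ≤ 5 times the norm. The assumption on ε
covers both signs of S₁. -/
theorem s1Model_lower_bound {ε : ℝ} (hε : |ε| ≤ 1) : ∀ᶠ x in 𝓝 (0 : ℝ × ℝ), ∀ w,
    ‖x‖ ^ 2 * ‖w‖ ≤ 5 * ‖fderiv ℝ (s1Model ε) x w‖ := by
  filter_upwards [Metric.ball_mem_nhds (0 : ℝ × ℝ) one_pos] with x hx w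
  have hx' : ‖x‖ < 1 := by simpa using hx
  have hx1 : |x.1| ≤ 1 := (norm_fst_le x).trans hx'.le
  have hx2 : |x.2| ≤ 1 := (norm_snd_le x).trans hx'.le
  have m0 : |w.1| ≤ ‖fderiv ℝ (s1Model ε) x w‖ := by
    simpa [fderiv_s1Model] using norm_le_pi_norm (fderiv ℝ (s1Model ε) x w) 0
  have m1 : 2 * |x.2| * |w.2| ≤ ‖fderiv ℝ (s1Model ε) x w‖ := by
    simpa [fderiv_s1Model, abs_mul] using norm_le_pi_norm (fderiv ℝ (s1Model ε) x w) 1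
  have m2 : |2 * x.1 * x.2 * w.1 + (x.1 ^ 2 + 3 * ε * x.2 ^ 2) * w.2|
      ≤ ‖fderiv ℝ (s1Model ε) x w‖ := by
    simpa [fderiv_s1Model] using norm_le_pi_norm (fderiv ℝ (s1Model ε) x w) 2
  generalize ‖fderiv ℝ (s1Model ε) x w‖ = m at *
  have hm : 0 ≤ m := (abs_nonneg _).trans m0
  have hy : |x.2| ^ 2 * |w.2| ≤ m := by
    nlinarith [mul_nonneg (abs_nonneg x.2) (abs_nonneg w.2)]
  have hxx : |x.1| ^ 2 * |w.2| ≤ 5 * m := by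
    have t1 : |2 * x.1 * x.2 * w.1| ≤ 2 * m := by
      rw [abs_mul, abs_mul, abs_mul, abs_two]
      calc 2 * |x.1| * |x.2| * |w.1| ≤ 2 * 1 * 1 * m := by gcongr
        _ = 2 * m := by ring
    have t2 : |3 * ε * x.2 ^ 2 * w.2| ≤ 3 / 2 * m := by
      rw [abs_mul, abs_mul, abs_mul, abs_pow, abs_of_pos (by norm_num : (0 : ℝ) < 3)]
      calc 3 * |ε| * |x.2| ^ 2 * |w.2| = 3 / 2 * |ε| * |x.2| * (2 * |x.2| * |w.2|) := by ring
        _ ≤ 3 / 2 * 1 * 1 * m := by gcongr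
        _ = 3 / 2 * m := by ring
    have t3 : |x.1| ^ 2 * |w.2| = |x.1 ^ 2 * w.2| := by rw [abs_mul, abs_pow]
    rw [t3]
    rw [abs_le] at *
    constructor <;> linarith
  have hw1 : ∀ a : ℝ, |a| ≤ 1 → |a| ^ 2 * |w.1| ≤ 5 * m := fun a ha => by
    have : |a| ^ 2 ≤ 1 := pow_le_one₀ (abs_nonneg a) ha
    nlinarith [abs_nonneg w.1]
  rw [Prod.norm_def, Prod.norm_def]
  simp only [Real.norm_eq_abs]
  rcases max_choice |x.1| |x.2| with h1 | h1 <;> rcases max_choice |w.1| |w.2| with h2 | h2 <;>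
    rw [h1, h2]
  · exact hw1 _ hx1
  · exact hxx
  · exact hw1 _ hx2
  · linarith

variable {f21 f31 : ℝ → ℝ} {f24 f33 f34 : ℝ × ℝ → ℝ} {f32 : ℝ × ℝ × ℝ → ℝ}

theorem IsS1NormalForm.f33_zero (hf : IsS1NormalForm f21 f31 f24 f33 f34 f32) : f33 0 = 0 :=
  hf.f33_axis.self_of_nhds

theorem IsS1NormalForm.partialFst_f33 (hf : IsS1NormalForm f21 f31 f24 f33 f34 f32) :
    partialFst f33 0 = 0 :=
  (hf.smooth33.partialFst_slice.self_of_nhds).trans hf.f33_u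

theorem IsS1NormalForm.partialFst_partialFst_f33
    (hf : IsS1NormalForm f21 f31 f24 f33 f34 f32) :
    partialFst (partialFst f33) 0 = 2 * c2 f33 := by
  refine (hf.smooth33.partialFst_two_slice.self_of_nhds).trans ?_
  rw [c2, iteratedDeriv_succ, iteratedDeriv_one]
  ring

/-- At (r, 0) the differential of f^0 sends (0, 1) to (0, 0, f33(r,0)). The quadratic lower bound
transported from the model gives r² ≤ K |f33(r,0)|, whereas c₂(0) = 0 would make f33(r,0) = O(r³).
-/
theorem IsS1NormalForm.c2_ne_zero (hf : IsS1NormalForm f21 f31 f24 f33 f34 f32) :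
    c2 f33 ≠ 0 := by
  intro hc
  obtain ⟨ε, hε, hA⟩ : ∃ ε : ℝ, |ε| ≤ 1 ∧
      AEquivalent (normalForm f21 f31 f24 f33 f34 f32 0) (s1Model ε) := by
    rcases hf.s1 with h | h
    · refine ⟨1, by simp, ?_⟩
      have : s1Model 1 = fun x => ![x.1, x.2 ^ 2, x.2 * (x.1 ^ 2 + x.2 ^ 2)] := by
        funext x
        simp [s1Model]
      rw [this]
      exact h
    · refine ⟨-1, by simp, ?_⟩
      have : s1Model (-1) = fun x => ![x.1, x.2 ^ 2, x.2 * (x.1 ^ 2 - x.2 ^ 2)] := by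
        funext x
        simp [s1Model, sub_eq_add_neg]
      rw [this]
      exact h
  have hjet := hf.eventually_jet
  obtain ⟨K, hK⟩ := hA.fderiv_lower_bound hjet.self_of_nhds.1
    (by ext i; fin_cases i <;> simp [normalForm]) (differentiable_s1Model ε) (by norm_num)
    (s1Model_lower_bound hε)
  have t : Tendsto (fun r : ℝ => (r, (0 : ℝ))) (𝓝 0) (𝓝 0) :=
    Continuous.tendsto' (by fun_prop) _ _ rfl
  have h33 : (fun r : ℝ => f33 (r, 0)) =O[𝓝 0] fun r => r ^ 3 := by
    have h1 := (hf.smooth33.isBigO_slice_taylor_two).comp_tendsto t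
    have h2 : (fun r : ℝ => ‖(r, (0 : ℝ))‖ ^ 3) =O[𝓝 0] fun r => r ^ 3 := by
      refine IsBigO.pow (IsBigO.of_bound 1 (Eventually.of_forall fun r => ?_)) 3
      simp
    refine (h1.trans h2).congr_left fun r => ?_
    simp [hf.f33_zero, hf.partialFst_f33, hf.partialFst_partialFst_f33, hc]
  have hsq : (fun r : ℝ => (0 : ℝ) * r + 1 * r ^ 2) =O[𝓝 0] fun r => r ^ 3 := by
    refine IsBigO.trans (IsBigO.of_bound K ?_) h33
    filter_upwards [t.eventually hK, t.eventually hjet] with r hr hj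
    have h1 := hr (0, 1)
    rw [hj.2.hasFDerivAt.fderiv] at h1
    have h2 : ‖(ContinuousLinearMap.pi ![ContinuousLinearMap.fst ℝ ℝ ℝ,
      partialFst (axisPart f21 f24) (r, 0) • ContinuousLinearMap.fst ℝ ℝ ℝ,
      partialFst (axisPart f31 f34) (r, 0) • ContinuousLinearMap.fst ℝ ℝ ℝ
        + f33 (r, 0) • ContinuousLinearMap.snd ℝ ℝ ℝ]) ((0 : ℝ), (1 : ℝ))‖ = ‖f33 (r, 0)‖ := by
      apply le_antisymm
      · rw [pi_norm_le_iff_of_nonneg (norm_nonneg _)]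
        intro i
        fin_cases i <;> simp
      · refine le_trans (le_of_eq ?_) (norm_le_pi_norm _ 2)
        simp
    rw [h2] at h1
    simpa using h1
  exact one_ne_zero (eq_zero_of_quadratic_isBigO_cube hsq).2

end Nondegeneracy

/-! ### Derivatives of u² f(u) at the origin. -/

section AxisDerivatives

theorem IsSmoothGerm.deriv {f : ℝ → ℝ} {x : ℝ} (hf : IsSmoothGerm f x) :
    IsSmoothGerm (deriv f) x := by
  filter_upwards [hf] with y hy
  have : ContDiffAt ℝ ∞ (fun z => fderiv ℝ f z 1) y :=
    (hy.fderiv_right (m := ∞) (by simp)).clm_apply contDiffAt_const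
  exact this

theorem IsSmoothGerm.eventually_hasDerivAt {f : ℝ → ℝ} {x : ℝ} (hf : IsSmoothGerm f x) :
    ∀ᶠ y in 𝓝 x, HasDerivAt f (_root_.deriv f y) y :=
  hf.mono fun _ hy => (hy.differentiableAt (by simp)).hasDerivAt

theorem IsSmoothGerm.deriv_sq_mul {f : ℝ → ℝ} (hf : IsSmoothGerm f 0) :
    _root_.deriv (fun u => u ^ 2 * f u)
      =ᶠ[𝓝 0] fun u => 2 * u * f u + u ^ 2 * _root_.deriv f u := by
  filter_upwards [hf.eventually_hasDerivAt] with u hu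
  refine HasDerivAt.deriv (((hasDerivAt_pow 2 u).mul hu).congr_deriv ?_)
  simp

theorem IsSmoothGerm.deriv_deriv_sq_mul {f : ℝ → ℝ} (hf : IsSmoothGerm f 0) :
    _root_.deriv (_root_.deriv fun u => u ^ 2 * f u) =ᶠ[𝓝 0]
      fun u => 2 * f u + 4 * u * _root_.deriv f u
        + u ^ 2 * _root_.deriv (_root_.deriv f) u := by
  refine hf.deriv_sq_mul.deriv.trans ?_
  filter_upwards [hf.eventually_hasDerivAt, hf.deriv.eventually_hasDerivAt] with u h1 h2
  refine HasDerivAt.deriv ?_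
  refine ((((hasDerivAt_id u).const_mul 2).mul h1).add
    ((hasDerivAt_pow 2 u).mul h2)).congr_deriv ?_
  simp
  ring

/-- The Leibniz rule at 0; with f = f31 this is the source of the term 3 f31'(0) in the criterion
for a11. -/
theorem IsSmoothGerm.hasDerivAt_deriv_deriv_sq_mul {f : ℝ → ℝ} (hf : IsSmoothGerm f 0) :
    HasDerivAt (_root_.deriv (_root_.deriv fun u => u ^ 2 * f u)) (6 * _root_.deriv f 0) 0 := by
  refine HasDerivAt.congr_of_eventuallyEq ?_ hf.deriv_deriv_sq_mul
  have h1 := hf.eventually_hasDerivAt.self_of_nhds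
  have h2 := hf.deriv.eventually_hasDerivAt.self_of_nhds
  have h3 := hf.deriv.deriv.eventually_hasDerivAt.self_of_nhds
  refine (((h1.const_mul 2).add (((hasDerivAt_id (0 : ℝ)).const_mul 4).mul h2)).add
    ((hasDerivAt_pow 2 (0 : ℝ)).mul h3)).congr_deriv ?_
  simp
  ring

variable {f : ℝ → ℝ} {g : ℝ × ℝ → ℝ}

theorem axisPart_slice (f : ℝ → ℝ) (g : ℝ × ℝ → ℝ) :
    (fun u => axisPart f g (u, 0)) = fun u => u ^ 2 * f u := by
  funext u
  simp [axisPart]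

theorem partialFst_axisPart_zero (hf : IsSmoothGerm f 0) (hg : IsSmoothGerm g 0) :
    partialFst (axisPart f g) 0 = 0 := by
  refine (hf.axisPart hg).partialFst_slice.self_of_nhds.trans ?_
  rw [axisPart_slice, hf.deriv_sq_mul.self_of_nhds]
  simp

theorem partialFst_partialFst_axisPart_zero (hf : IsSmoothGerm f 0) (hg : IsSmoothGerm g 0) :
    partialFst (partialFst (axisPart f g)) 0 = 2 * f 0 := by
  refine (hf.axisPart hg).partialFst_two_slice.self_of_nhds.trans ?_
  rw [axisPart_slice, hf.deriv_deriv_sq_mul.self_of_nhds]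
  simp

theorem hasDerivAt_partialFst_partialFst_axisPart (hf : IsSmoothGerm f 0)
    (hg : IsSmoothGerm g 0) :
    HasDerivAt (fun u => partialFst (partialFst (axisPart f g)) (u, 0)) (6 * deriv f 0) 0 := by
  refine HasDerivAt.congr_of_eventuallyEq ?_ (hf.axisPart hg).partialFst_two_slice
  rw [axisPart_slice]
  exact hf.hasDerivAt_deriv_deriv_sq_mul

end AxisDerivatives

/-! ### Asymptotics along a curve with s = O(u²). -/

section Limits

variable {l : Filter ℝ}

theorem boundedAlong_of_isBigO_one {a : ℝ → ℝ} (h : a =O[l] fun _ => (1 : ℝ)) :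
    BoundedAlong l a := by
  obtain ⟨M, hM⟩ := h.bound
  exact ⟨M, hM.mono fun t ht => by simpa using ht⟩

theorem not_boundedAlong_of_tendsto_abs_atTop [l.NeBot] {a : ℝ → ℝ}
    (h : Tendsto (fun t => |a t|) l atTop) : ¬ BoundedAlong l a := by
  rintro ⟨M, hM⟩
  obtain ⟨t, h1, h2⟩ := (hM.and (h.eventually_gt_atTop M)).exists
  exact absurd h1 (not_le.2 h2)

variable {u s : ℝ → ℝ}

/-- On the zero set of a function `F` with `F(u, s) = s + O(2)`, the variable `s` is `O(u²)`. -/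
theorem isBigO_sq_of_zero {F : ℝ × ℝ → ℝ} (hF : ContDiffAt ℝ ∞ F 0) (h0 : F 0 = 0)
    (h1 : fderiv ℝ F 0 (1, 0) = 0) (h2 : fderiv ℝ F 0 (0, 1) = 1)
    (hu : Tendsto u l (𝓝 0)) (hs : Tendsto s l (𝓝 0)) (hz : ∀ᶠ t in l, F (u t, s t) = 0) :
    s =O[l] fun t => u t ^ 2 := by
  have ht : Tendsto (fun t => (u t, s t)) l (𝓝 0) := hu.prodMk_nhds hs
  obtain ⟨C, hC, hb⟩ := (hF.isBigO_sub_fderiv.comp_tendsto ht).exists_pos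
  refine IsBigO.of_bound C ?_
  have hsmall : ∀ᶠ t in l, |s t| < 1 / (2 * C) := by
    have := hs.abs
    rw [abs_zero] at this
    exact this.eventually (gt_mem_nhds (by positivity))
  filter_upwards [hb.bound, hz, hsmall] with t h3 h4 h5
  have hlin : fderiv ℝ F 0 (u t, s t) = s t := by
    have : ((u t, s t) : ℝ × ℝ) = u t • (1, 0) + s t • (0, 1) := by simp
    rw [this, map_add, map_smul, map_smul, h1, h2]
    simp
  simp only [Function.comp_apply, zero_add, h4, h0, hlin, norm_pow, norm_norm] at h3
  rw [Prod.norm_def] at h3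
  simp only [sub_zero, zero_sub, norm_neg, Real.norm_eq_abs] at h3 ⊢
  rw [abs_pow]
  -- The norm is a maximum. If |s| attains it, then |s| ≤ C|s|² with C|s| ≤ 1/2, which forces s = 0.
  rcases max_choice |u t| |s t| with h6 | h6 <;> rw [h6] at h3
  · exact h3
  · have h7 : C * |s t| ≤ 1 / 2 := by
      rw [lt_div_iff₀ (by positivity)] at h5
      linarith
    have h8 : |s t| ≤ 0 := by nlinarith [abs_nonneg (s t)]
    have h9 : 0 ≤ C * |u t| ^ 2 := by positivity
    linarith

/-- Expansion of a smooth function of `(u, s)` in powers of `u` if `s = O(u²)`. -/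
theorem ContDiffAt.isBigO_expansion {F : ℝ × ℝ → ℝ} (hF : ContDiffAt ℝ ∞ F 0)
    (hu : Tendsto u l (𝓝 0)) (hs : Tendsto s l (𝓝 0)) (hsu : s =O[l] fun t => u t ^ 2) :
    (fun t => F (u t, s t) - F 0 - _root_.partialFst F 0 * u t) =O[l] fun t => u t ^ 2 := by
  have ht : Tendsto (fun t => (u t, s t)) l (𝓝 0) := hu.prodMk_nhds hs
  have hsu1 : s =O[l] u := by
    refine hsu.trans ?_
    have := ((isBigO_refl u l).mul (hu.isBigO_one ℝ))
    simpa [pow_two] using this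
  have hn : (fun t => (u t, s t)) =O[l] u := (isBigO_refl u l).prod_left hsu1
  have h1 := ((hF.isBigO_sub_fderiv.comp_tendsto ht).trans (hn.norm_left.pow 2)).add
    (hsu.const_mul_left (fderiv ℝ F 0 (0, 1)))
  refine h1.congr_left fun t => ?_
  have hlin : fderiv ℝ F 0 (u t, s t)
      = u t * fderiv ℝ F 0 (1, 0) + s t * fderiv ℝ F 0 (0, 1) := by
    have : ((u t, s t) : ℝ × ℝ) = u t • (1, 0) + s t • (0, 1) := by simp
    rw [this, map_add, map_smul, map_smul]
    simp
  simp only [Function.comp_apply, zero_add, hlin, _root_.partialFst]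
  ring

theorem tendsto_div_of_expansion {g : ℝ → ℝ} {c : ℝ} (hu : Tendsto u l (𝓝 0))
    (hu0 : ∀ᶠ t in l, u t ≠ 0) (hg : (fun t => g t - c * u t) =O[l] fun t => u t ^ 2) :
    Tendsto (fun t => g t / u t) l (𝓝 c) := by
  have h1 : (fun t => (g t - c * u t) * (u t)⁻¹) =O[l] fun t => u t ^ 2 * (u t)⁻¹ :=
    hg.mul (isBigO_refl _ _)
  have h2 : Tendsto (fun t => u t ^ 2 * (u t)⁻¹) l (𝓝 0) := by
    refine hu.congr' ?_
    filter_upwards [hu0] with t ht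
    field_simp
  have h3 := (h1.trans_tendsto h2).add_const c
  rw [zero_add] at h3
  refine h3.congr' ?_
  filter_upwards [hu0] with t ht
  field_simp
  ring

/-- Behaviour of the Bruce-West coefficients in terms of the expansions of the jet. -/
theorem bruceWest_limits [l.NeBot] {A B A' B' k h a20 a11 a02 : ℝ → ℝ} {α c e₀ e₁ : ℝ}
    (hu : Tendsto u l (𝓝 0)) (hu0 : ∀ᶠ t in l, u t ≠ 0)
    (hA : Tendsto A l (𝓝 0)) (hB : Tendsto B l (𝓝 0)) (hk : Tendsto k l (𝓝 0))
    (hA' : Tendsto A' l (𝓝 α)) (hc : c ≠ 0)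
    (hh : (fun t => h t - c * u t) =O[l] fun t => u t ^ 2)
    (he : (fun t => (k t * A' t - B' t) - e₀ - e₁ * u t) =O[l] fun t => u t ^ 2)
    (hcoef : ∀ᶠ t in l,
      a02 t = 2 * √(1 + A t ^ 2 + B t ^ 2) * √(1 + k t ^ 2 + (B t - k t * A t) ^ 2) ^ 3
        / h t ^ 2 ∧
      a20 t = ((1 + B t * (B t - k t * A t)) * A' t
          + (k t - A t * (B t - k t * A t)) * (k t * A' t)
          + (1 + k t ^ 2 + (B t - k t * A t) ^ 2) * (k t * A' t - B' t) ^ 2 / (2 * h t ^ 2)) /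
        ((1 + A t ^ 2 + B t ^ 2) * √(1 + A t ^ 2 + B t ^ 2)
          * √(1 + k t ^ 2 + (B t - k t * A t) ^ 2)) ∧
      |a11 t| = |k t - A t * (B t - k t * A t)
        + (1 + k t ^ 2 + (B t - k t * A t) ^ 2) * (k t * A' t - B' t) / h t ^ 2|
          / √(1 + A t ^ 2 + B t ^ 2)) :
    (e₀ ≠ 0 → Tendsto a20 l atTop) ∧ (e₀ = 0 → BoundedAlong l a20) ∧
    (e₀ ≠ 0 ∨ e₁ ≠ 0 → Tendsto (fun t => |a11 t|) l atTop) ∧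
    (e₀ = 0 ∧ e₁ = 0 → BoundedAlong l a11) ∧ Tendsto a02 l atTop := by
  obtain ⟨e, hedef⟩ : ∃ e : ℝ → ℝ, ∀ t, e t = k t * A' t - B' t := ⟨_, fun _ => rfl⟩
  simp only [← hedef] at he hcoef
  obtain ⟨D, hD⟩ : ∃ D : ℝ → ℝ, ∀ t, D t = B t - k t * A t := ⟨_, fun _ => rfl⟩
  simp only [← hD] at hcoef
  have tD : Tendsto D l (𝓝 0) := by
    have := hB.sub (hk.mul hA)
    simp only [mul_zero, sub_zero] at this
    exact this.congr fun t => (hD t).symm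
  obtain ⟨N, hN⟩ : ∃ N : ℝ → ℝ, ∀ t, N t = 1 + A t ^ 2 + B t ^ 2 := ⟨_, fun _ => rfl⟩
  obtain ⟨M, hM⟩ : ∃ M : ℝ → ℝ, ∀ t, M t = 1 + k t ^ 2 + D t ^ 2 := ⟨_, fun _ => rfl⟩
  simp only [← hN, ← hM] at hcoef
  have tN : Tendsto N l (𝓝 1) := by
    have := (tendsto_const_nhds (x := (1 : ℝ))).add (hA.pow 2) |>.add (hB.pow 2)
    norm_num at this
    exact this.congr fun t => (hN t).symm
  have tM : Tendsto M l (𝓝 1) := by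
    have := (tendsto_const_nhds (x := (1 : ℝ))).add (hk.pow 2) |>.add (tD.pow 2)
    norm_num at this
    exact this.congr fun t => (hM t).symm
  have tsN : Tendsto (fun t => √(N t)) l (𝓝 1) := by simpa using tN.sqrt
  have tsM : Tendsto (fun t => √(M t)) l (𝓝 1) := by simpa using tM.sqrt
  have thu : Tendsto (fun t => h t / u t) l (𝓝 c) := tendsto_div_of_expansion hu hu0 hh
  have hh0 : ∀ᶠ t in l, h t ≠ 0 := by
    filter_upwards [thu.eventually_ne hc] with t ht h0
    simp [h0] at ht
  have th : Tendsto h l (𝓝 0) := by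
    have := thu.mul hu
    rw [mul_zero] at this
    refine this.congr' ?_
    filter_upwards [hu0] with t ht
    field_simp
  have thinv : Tendsto (fun t => |h t|⁻¹) l atTop := by
    refine tendsto_inv_nhdsGT_zero.comp (tendsto_nhdsWithin_iff.2 ⟨by simpa using th.abs, ?_⟩)
    filter_upwards [hh0] with t ht
    simpa using ht
  have thinv2 : Tendsto (fun t => (h t ^ 2)⁻¹) l atTop := by
    refine (thinv.atTop_mul_atTop₀ thinv).congr fun t => ?_
    rw [← mul_inv, abs_mul_abs_self, pow_two]
  have te : Tendsto e l (𝓝 e₀) := by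
    have h1 : Tendsto (fun t => u t ^ 2) l (𝓝 0) := by simpa using hu.pow 2
    have h2 := (he.trans_tendsto h1).add ((hu.const_mul e₁).add_const e₀)
    simp only [mul_zero, zero_add] at h2
    exact h2.congr fun t => by ring
  have teh : e₀ = 0 → Tendsto (fun t => e t / h t) l (𝓝 (e₁ / c)) := by
    rintro rfl
    simp only [sub_zero] at he
    have h1 := (tendsto_div_of_expansion hu hu0 he).div thu hc
    refine h1.congr' ?_
    filter_upwards [hu0] with t ht
    simp only [Pi.div_apply]
    field_simp
  have tden : Tendsto (fun t => (N t * √(N t) * √(M t))⁻¹) l (𝓝 1) := by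
    have := ((tN.mul tsN).mul tsM).inv₀ (by norm_num)
    simpa using this
  have tP : Tendsto (fun t => (1 + B t * D t) * A' t + (k t - A t * D t) * (k t * A' t)) l
      (𝓝 α) := by
    have := (((hB.mul tD).const_add 1).mul hA').add ((hk.sub (hA.mul tD)).mul (hk.mul hA'))
    simpa using this
  have tR : Tendsto (fun t => k t - A t * D t) l (𝓝 0) := by
    simpa using hk.sub (hA.mul tD)
  -- For e₀ = 0 one factor 1/h is spent on making e/h converge to e₁/c ≠ 0; the other still
  -- diverges.
  have ha11 : e₀ ≠ 0 ∨ e₁ ≠ 0 → Tendsto (fun t => |e t / h t ^ 2|) l atTop := by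
    intro hne
    by_cases h0 : e₀ = 0
    · have h1 : 0 < |e₁ / c| := abs_pos.2 (div_ne_zero (hne.resolve_left (not_not.2 h0)) hc)
      refine ((teh h0).abs.pos_mul_atTop h1 thinv).congr fun t => ?_
      rw [← abs_inv, ← abs_mul, pow_two, ← div_eq_mul_inv, div_div]
    · refine (te.abs.pos_mul_atTop (abs_pos.2 h0) thinv2).congr fun t => ?_
      rw [abs_div, abs_of_nonneg (sq_nonneg (h t)), div_eq_mul_inv]
  refine ⟨fun h0 => ?_, fun h0 => ?_, fun hne => ?_, fun h0 => ?_, ?_⟩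
  · have h1 : Tendsto (fun t => M t * e t ^ 2 / 2) l (𝓝 (1 * e₀ ^ 2 / 2)) :=
      (tM.mul (te.pow 2)).div_const 2
    have h2 := tP.add_atTop (h1.pos_mul_atTop (by positivity) thinv2)
    refine (h2.atTop_mul_pos one_pos tden).congr' ?_
    filter_upwards [hcoef, hh0] with t ht hht
    rw [ht.2.1]
    field_simp
  · have h1 := (tP.add ((tM.mul ((teh h0).pow 2)).div_const 2)).mul tden
    refine boundedAlong_of_isBigO_one ((h1.congr' ?_).isBigO_one ℝ)
    filter_upwards [hcoef, hh0] with t ht hht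
    rw [ht.2.1]
    field_simp
  · have h1 : Tendsto (fun t => |M t| * |e t / h t ^ 2|) l atTop :=
      tM.abs.pos_mul_atTop (by simp) (ha11 hne)
    have h2 : Tendsto (fun t => -|k t - A t * D t|) l (𝓝 0) := by simpa using tR.abs.neg
    have h3 := h2.add_atTop h1
    have h4 : Tendsto (fun t => |k t - A t * D t + M t * e t / h t ^ 2|) l atTop := by
      refine tendsto_atTop_mono (fun t => ?_) h3
      rw [← abs_mul, mul_div_assoc]
      -- Reverse triangle inequality: the summand that tends to 0 cannot cancel the divergent one.
      have := abs_sub_abs_le_abs_sub (M t * (e t / h t ^ 2)) (-(k t - A t * D t))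
      rw [abs_neg, sub_neg_eq_add, add_comm (M t * (e t / h t ^ 2))] at this
      linarith
    have h5 : Tendsto (fun t => (√(N t))⁻¹) l (𝓝 1) := by simpa using tsN.inv₀ one_ne_zero
    refine (h4.atTop_mul_pos one_pos h5).congr' ?_
    filter_upwards [hcoef] with t ht
    exact (ht.2.2.trans (div_eq_mul_inv _ _)).symm
  · obtain ⟨rfl, rfl⟩ := h0
    have h1 : e =O[l] fun t => u t ^ 2 := he.congr_left fun t => by ring
    -- Since c ≠ 0, h is of exact order u, so e = O(u²) gives e/h² = O(1).
    have h2 : u =O[l] h := by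
      have h3 : Tendsto (fun t => u t / h t) l (𝓝 c⁻¹) := by
        refine (thu.inv₀ hc).congr fun t => ?_
        rw [inv_div]
      have h4 := (h3.isBigO_one ℝ).mul (isBigO_refl h l)
      simp only [one_mul] at h4
      refine h4.congr' ?_ EventuallyEq.rfl
      filter_upwards [hh0] with t ht
      field_simp
    have h3 : (fun t => e t / h t ^ 2) =O[l] fun _ => (1 : ℝ) := by
      have h4 := (h1.trans (h2.pow 2)).mul (isBigO_refl (fun t => (h t ^ 2)⁻¹) l)
      refine h4.congr' EventuallyEq.rfl ?_
      filter_upwards [hh0] with t ht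
      field_simp
    have h4 : (fun t => k t - A t * D t + M t * e t / h t ^ 2) =O[l] fun _ => (1 : ℝ) := by
      refine (tR.isBigO_one ℝ).add ?_
      have := (tM.isBigO_one ℝ).mul h3
      simp only [mul_one] at this
      exact this.congr_left fun t => by ring
    have h5 : (fun t => (√(N t))⁻¹) =O[l] fun _ => (1 : ℝ) :=
      (tsN.inv₀ one_ne_zero).isBigO_one ℝ
    have h6 := h4.abs_left.mul h5
    simp only [mul_one] at h6
    refine boundedAlong_of_isBigO_one (isBigO_abs_left.1 (h6.congr' ?_ EventuallyEq.rfl))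
    filter_upwards [hcoef] with t ht
    exact (ht.2.2.trans (div_eq_mul_inv _ _)).symm
  · have h1 : Tendsto (fun t => 2 * √(N t) * √(M t) ^ 3) l (𝓝 (2 * 1 * 1 ^ 3)) :=
      (tsN.const_mul 2).mul (tsM.pow 3)
    refine (h1.pos_mul_atTop (by norm_num) thinv2).congr' ?_
    filter_upwards [hcoef] with t ht
    rw [ht.1, div_eq_mul_inv]

end Limits

/-! ### The theorem. -/

section Main

variable {f21 f31 : ℝ → ℝ} {f24 f33 f34 : ℝ × ℝ → ℝ} {f32 : ℝ × ℝ × ℝ → ℝ}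

theorem IsS1NormalForm.fderiv_f33_snd (hf : IsS1NormalForm f21 f31 f24 f33 f34 f32) :
    fderiv ℝ f33 0 (0, 1) = 1 := by
  have hd : ContDiffAt ℝ ∞ f33 0 := hf.smooth33.self_of_nhds
  have h1 : HasDerivAt (fun s : ℝ => f33 (0, s)) (fderiv ℝ f33 (0, 0) (0, 1)) 0 :=
    (hd.differentiableAt (by simp)).hasFDerivAt.comp_hasDerivAt (0 : ℝ)
      ((hasDerivAt_const (0 : ℝ) (0 : ℝ)).prodMk (hasDerivAt_id (0 : ℝ)))
  exact h1.unique ((hasDerivAt_id (0 : ℝ)).congr_of_eventuallyEq hf.f33_axis)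

theorem tendsto_deformParam (f33 : ℝ × ℝ → ℝ) : Tendsto (deformParam f33) (𝓝 0) (𝓝 0) := by
  unfold deformParam
  exact Continuous.tendsto' (by fun_prop) _ _ (by simp)

theorem deformParam_ne_zero (hc : c2 f33 ≠ 0) {t : ℝ} (ht : t ≠ 0) : deformParam f33 t ≠ 0 := by
  have : Real.sign (c2 f33) ≠ 0 := by rwa [Ne, Real.sign_eq_zero_iff]
  simp [deformParam, this, ht]

theorem IsS1NormalForm.contDiffAt_axis_f32 (hf : IsS1NormalForm f21 f31 f24 f33 f34 f32) :
    ContDiffAt ℝ ∞ (fun x : ℝ × ℝ => f32 (x.1, 0, x.2)) 0 := by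
  have h : ContDiffAt ℝ ∞ f32 0 := hf.smooth32.self_of_nhds
  exact ContDiffAt.comp (g := f32) (f := fun x : ℝ × ℝ => (x.1, (0 : ℝ), x.2)) 0 h
    (by fun_prop)

end Main

theorem corollary3p7
    (f21 f31 : ℝ → ℝ) (f24 f33 f34 : ℝ × ℝ → ℝ) (f32 : ℝ × ℝ × ℝ → ℝ)
    (hf : IsS1NormalForm f21 f31 f24 f33 f34 f32)
    (u : ℝ → ℝ) (hu0 : u 0 = 0) (hu : ContinuousAt u 0)
    (hsing : ∀ᶠ t in 𝓝 (0 : ℝ),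
      (u t, (0 : ℝ)) ∈ singularSet (normalForm f21 f31 f24 f33 f34 f32 (deformParam f33 t))) :
    (∀ᶠ t in 𝓝[≠] (0 : ℝ), ∃ b20 b11 b02 : ℝ,
      IsBruceWest (normalForm f21 f31 f24 f33 f34 f32 (deformParam f33 t)) (u t, 0)
        b20 b11 b02) ∧
    ∀ a20 a11 a02 : ℝ → ℝ,
      (∀ᶠ t in 𝓝[≠] (0 : ℝ),
        IsBruceWest (normalForm f21 f31 f24 f33 f34 f32 (deformParam f33 t)) (u t, 0)
          (a20 t) (a11 t) (a02 t)) →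
      ∀ l : Filter ℝ, (l = 𝓝[≠] 0 ∨ l = 𝓝[>] 0 ∨ l = 𝓝[<] 0) →
        (f31 0 ≠ 0 ↔ Tendsto a20 l atTop) ∧
        (f31 0 = 0 ↔ BoundedAlong l a20) ∧
        ((f31 0 ≠ 0 ∨
            2 * c3 f33 * f31 0 - c20 f33 ^ 2 * (3 * deriv f31 0 - d1 f32 * f21 0) ≠ 0) ↔
          Tendsto (fun t => |a11 t|) l atTop) ∧
        ((f31 0 = 0 ∧ 3 * deriv f31 0 - d1 f32 * f21 0 = 0) ↔ BoundedAlong l a11) ∧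
        Tendsto a02 l atTop := by
  have hc := hf.c2_ne_zero
  obtain ⟨s, hs⟩ : ∃ s, s = deformParam f33 := ⟨_, rfl⟩
  have tu : Tendsto u (𝓝 0) (𝓝 0) := by rwa [ContinuousAt, hu0] at hu
  have ts : Tendsto s (𝓝 0) (𝓝 0) := hs ▸ tendsto_deformParam f33
  have tx : Tendsto (fun t => (u t, s t)) (𝓝 0) (𝓝 (0 : ℝ × ℝ)) := tu.prodMk_nhds ts
  have hs0 : ∀ t, t ≠ 0 → s t ≠ 0 := fun t ht => hs ▸ deformParam_ne_zero hc ht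
  rw [← hs] at hsing ⊢
  have hjet := tx.eventually hf.eventually_jet
  have hzero : ∀ᶠ t in 𝓝 0, f33 (u t, s t) = 0 := by
    filter_upwards [hjet, hsing] with t h1 h2
    exact h1.2.eq_zero_of_mem_singularSet h2
  have h33 : ContDiffAt ℝ ∞ f33 0 := hf.smooth33.self_of_nhds
  have hsu : s =O[𝓝 0] fun t => u t ^ 2 :=
    isBigO_sq_of_zero h33 hf.f33_zero hf.partialFst_f33 hf.fderiv_f33_snd tu ts hzero
  -- At u = 0 the equation f33 = 0 reads s = 0, impossible for t ≠ 0.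
  have hune : ∀ᶠ t in 𝓝[≠] 0, u t ≠ 0 := by
    filter_upwards [self_mem_nhdsWithin, hzero.filter_mono nhdsWithin_le_nhds,
      (ts.eventually hf.f33_axis).filter_mono nhdsWithin_le_nhds] with t h1 h2 h3 h4
    rw [h4, h3] at h2
    exact hs0 t h1 h2
  have hh : (fun t => partialFst f33 (u t, s t) - 2 * c2 f33 * u t) =O[𝓝 0]
      fun t => u t ^ 2 := by
    refine (h33.partialFst.isBigO_expansion tu ts hsu).congr_left fun t => ?_
    rw [hf.partialFst_f33, hf.partialFst_partialFst_f33, sub_zero]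
  have h2c : 2 * c2 f33 ≠ 0 := mul_ne_zero two_ne_zero hc
  have hjet0 : ∀ᶠ t in 𝓝 0, HasUmbrellaJet (normalForm f21 f31 f24 f33 f34 f32 (s t)) (u t, 0)
      (partialFst (axisPart f21 f24) (u t, s t)) (partialFst (axisPart f31 f34) (u t, s t))
      (partialFst (partialFst (axisPart f21 f24)) (u t, s t))
      (partialFst (partialFst (axisPart f31 f34)) (u t, s t))
      (f32 (u t, 0, s t)) (partialFst f33 (u t, s t)) 0 := by
    filter_upwards [hjet, hzero] with t h1 h2
    simpa only [h2] using h1.2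
  refine ⟨?_, ?_⟩
  · have tdiv := tendsto_div_of_expansion (tu.mono_left nhdsWithin_le_nhds) hune
      (hh.mono nhdsWithin_le_nhds)
    filter_upwards [tdiv.eventually_ne h2c, hjet.filter_mono nhdsWithin_le_nhds,
      hjet0.filter_mono nhdsWithin_le_nhds] with t h1 h2 h3
    refine h3.exists_bruceWest h2.1 fun h0 => h1 ?_
    rw [h0, zero_div]
  intro a20 a11 a02 hBW l hl
  obtain ⟨hne, hle⟩ : l.NeBot ∧ l ≤ 𝓝[≠] 0 := by
    rcases hl with rfl | rfl | rfl
    · exact ⟨inferInstance, le_rfl⟩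
    · exact ⟨inferInstance, nhdsWithin_mono _ fun x hx => ne_of_gt hx⟩
    · exact ⟨inferInstance, nhdsWithin_mono _ fun x hx => ne_of_lt hx⟩
  have hle0 : l ≤ 𝓝 0 := hle.trans nhdsWithin_le_nhds
  have s21 := hf.smooth21.axisPart hf.smooth24
  have s31 := hf.smooth31.axisPart hf.smooth34
  have U0 : ContDiffAt ℝ ∞ (axisPart f21 f24) 0 := s21.self_of_nhds
  have W0 : ContDiffAt ℝ ∞ (axisPart f31 f34) 0 := s31.self_of_nhds
  have hk0 := hf.contDiffAt_axis_f32
  have txl := tx.mono_left hle0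
  have tA : Tendsto (fun t => partialFst (axisPart f21 f24) (u t, s t)) l (𝓝 0) := by
    rw [← partialFst_axisPart_zero hf.smooth21 hf.smooth24]
    exact U0.partialFst.continuousAt.tendsto.comp txl
  have tB : Tendsto (fun t => partialFst (axisPart f31 f34) (u t, s t)) l (𝓝 0) := by
    rw [← partialFst_axisPart_zero hf.smooth31 hf.smooth34]
    exact W0.partialFst.continuousAt.tendsto.comp txl
  have tA' : Tendsto (fun t => partialFst (partialFst (axisPart f21 f24)) (u t, s t)) l
      (𝓝 (2 * f21 0)) := by
    rw [← partialFst_partialFst_axisPart_zero hf.smooth21 hf.smooth24]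
    exact U0.partialFst.partialFst.continuousAt.tendsto.comp txl
  have tk : Tendsto (fun t => f32 (u t, 0, s t)) l (𝓝 0) := by
    have := hk0.continuousAt.tendsto.comp txl
    simpa [Function.comp_def, hf.f32_zero] using this
  -- E is kA' - B' as a function of (u, s). In its u-derivative at 0 the derivative of A' drops out
  -- because f32 vanishes at the origin.
  let E : ℝ × ℝ → ℝ := fun x => f32 (x.1, 0, x.2) * partialFst (partialFst (axisPart f21 f24)) x
    - partialFst (partialFst (axisPart f31 f34)) x
  have hE : ContDiffAt ℝ ∞ E 0 :=
    (hk0.mul U0.partialFst.partialFst).sub W0.partialFst.partialFst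
  have hE0 : E 0 = -2 * f31 0 := by
    have h1 : E 0 = f32 (0, 0, 0) * partialFst (partialFst (axisPart f21 f24)) 0
      - partialFst (partialFst (axisPart f31 f34)) 0 := rfl
    rw [h1, hf.f32_zero, partialFst_partialFst_axisPart_zero hf.smooth31 hf.smooth34]
    ring
  have hE1 : partialFst E 0 = -2 * (3 * deriv f31 0 - d1 f32 * f21 0) := by
    have h1 : HasDerivAt (fun v => E (v, 0)) (partialFst E 0) 0 :=
      ContDiffAt.hasDerivAt_partialFst (u := 0) (s := 0) hE
    have h2 : HasDerivAt (fun v : ℝ => f32 (v, 0, 0)) (d1 f32) 0 :=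
      (ContDiffAt.hasDerivAt_partialFst (u := 0) (s := 0) hk0).differentiableAt.hasDerivAt
    have h3 := (ContDiffAt.hasDerivAt_partialFst (u := 0) (s := 0) U0.partialFst.partialFst)
    have h4 := hasDerivAt_partialFst_partialFst_axisPart hf.smooth31 hf.smooth34
    refine (h1.unique ((h2.mul h3).sub h4)).trans ?_
    have h5 : partialFst (partialFst (axisPart f21 f24)) (0, 0) = 2 * f21 0 :=
      partialFst_partialFst_axisPart_zero hf.smooth21 hf.smooth24
    rw [hf.f32_zero, h5]
    ring
  have he := hE.isBigO_expansion tu ts hsu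
  rw [hE0, hE1] at he
  have hcoef := (hBW.and (hjet0.filter_mono nhdsWithin_le_nhds)).mono
    fun t ht => ht.2.bruceWest_eq ht.1
  obtain ⟨r1, r2, r3, r4, r5⟩ := bruceWest_limits (tu.mono_left hle0) (hune.filter_mono hle)
    tA tB tk tA' h2c (hh.mono hle0) (he.mono hle0) (hcoef.filter_mono hle)
  have hz0 : -2 * f31 0 = 0 ↔ f31 0 = 0 := by simp
  have hz1 : -2 * (3 * deriv f31 0 - d1 f32 * f21 0) = 0 ↔
      3 * deriv f31 0 - d1 f32 * f21 0 = 0 := by simp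
  rw [ne_eq, ne_eq, hz0, hz1] at r3
  rw [ne_eq, hz0] at r1
  rw [hz0] at r2
  rw [hz0, hz1] at r4
  have hc20 : c20 f33 ^ 2 ≠ 0 := by
    rw [c20, Real.sq_sqrt (abs_nonneg _)]
    exact abs_ne_zero.2 hc
  -- If f31(0) = 0 the c₃ term disappears and the nonzero factor c₂₀² can be cancelled; otherwise
  -- both sides hold.
  have hiff : (f31 0 ≠ 0 ∨
      2 * c3 f33 * f31 0 - c20 f33 ^ 2 * (3 * deriv f31 0 - d1 f32 * f21 0) ≠ 0) ↔
      (¬ f31 0 = 0 ∨ ¬ 3 * deriv f31 0 - d1 f32 * f21 0 = 0) := by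
    by_cases h0 : f31 0 = 0
    · simp only [h0, ne_eq, not_true_eq_false, false_or, mul_zero, zero_sub, neg_eq_zero,
        mul_eq_zero, hc20]
    · simp [h0]
  rw [hiff]
  -- Divergence and boundedness exclude each other along a nontrivial filter, so the forward
  -- implications for complementary cases yield the converses.
  refine ⟨⟨r1, fun h1 h0 => ?_⟩, ⟨r2, fun h1 => ?_⟩, ⟨r3, fun h1 => ?_⟩, ⟨r4, fun h1 => ?_⟩, r5⟩
  · exact not_boundedAlong_of_tendsto_abs_atTop (tendsto_abs_atTop_atTop.comp h1) (r2 h0)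
  · by_contra h0
    exact not_boundedAlong_of_tendsto_abs_atTop (tendsto_abs_atTop_atTop.comp (r1 h0)) h1
  · by_contra h0
    push Not at h0
    exact not_boundedAlong_of_tendsto_abs_atTop h1 (r4 h0)
  · by_contra h0
    exact not_boundedAlong_of_tendsto_abs_atTop (r3 (not_and_or.1 h0)) h1
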